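/- Let $TL_n=TL_n(0)$ be the complex Temperley–Lieb algebra with loop value $\delta=0$, generated by $e_1,\dots,e_{n-1}$ with $e_i^2=0$, $e_ie_{i\pm1}e_i=e_i$, $e_ie_j=e_je_i$ for $|i-j|>1$, realised by planar diagrams (the left factor of a product is on top), and let $TL_\infty=\bigcup_n TL_n$, where $TL_n\subset TL_{n+1}$ by adding a vertical strand on the right. Let $\dagger$ be the linear reflection of diagrams about the horizontal axis. For $k$ odd let $f_k\in TL_k$ be the Jones–Wenzl idempotent, i.e. the unique non-zero idempotent with $e_if_k=f_ke_i=0$ for $1\le i\le k-1$. *Fusion rules.* For $k$ odd define half diagrams with $k+2$ points on top: $a_k=f_k\otimes\cup$ (from $k$ to $k+2$ points); $b_k=(f_k\otimes 1_2)(1_{k-1}\otimes\cup\otimes 1)f_k$ (from $k$ to $k+2$ points); and, for $k\ge3$, $c_k=(f_k\otimes 1_2)(1_{k-2}\otimes\Cup)f_{k-2}$ (from $k-2$ to $k+2$ points), where $\Cup$ is two nested cups. A path $p$ of length $m$ starts with $k=1$ strand and takes $m$ steps, each from the current odd number $k$ of strands either to $k+2$, or to $k$ along one of two edges $+,-$,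 or (if $k\ge 3$) to $k-2$. Its half diagram $v_p$ is $1$ for the empty path, and a step multiplies $v_p\otimes 1_2$ on the right by, respectively, $$f_{k+2},\qquad \tfrac1{\sqrt2}(a_k+b_k),\qquad \tfrac{i}{\sqrt2}(a_k-b_k),\qquad i\sqrt{\tfrac{k-1}{k+1}}\;c_k .$$ For paths $p,q$ of length $m$ with the same end point put $v_{p,q}=v_pv_q^\dagger\in TL_{2m+1}$. *Theorem.* There is exactly one conjugate-linear, anti-multiplicative involution $\diamond$ of $TL_\infty$ with $v_{p,q}^\diamond=v_{q,p}$ for all such $p,q$ (the corrected involution). It is given on generators as follows. 1. $e_1^\diamond=e_2$. 2. For $n>2$ even, $$e_n^\diamond=\sum_{k}\sum_{p}(v_p\otimes 1_2)\,b_kb_k^\dagger\,(v_p^\dagger\otimes 1_2)=\sum_{k}\sum_{p}(v_p\otimes 1_2)\,(f_k\otimes 1_2)\,e_k\,(f_k\otimes 1_2)\,(v_p^\dagger\otimes 1_2),$$ where $k$ runs over the odd numbers $1\le k\le n-1$ and $p$ over the paths of length $\frac n2-1$ ending at $k$ strands. 3. For $n>2$ odd, $$e_n^\diamond=e_{n-1}+e_{n+1}+e_{n-1}e_ne_{n+1}+e_{n+1}e_ne_{n-1}-e_{n-1}e_{n+1}e_n-e_ne_{n-1}e_{n+1}.$$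 For example, $e_4^\diamond=e_1+e_3-e_1e_2e_3-e_3e_2e_1+e_1e_3e_2+e_2e_1e_3$. -/

import Mathlib

open scoped ComplexConjugate

namespace TemperleyLieb

noncomputable section

/-! ## Planar diagrams on the strands `1, 2, 3, …` -/

/-- Elementary planar diagrams on half-infinitely many strands, numbered `1, 2, 3, …` from the left.
`cup i` joins the points `i + 1` and `i + 2` on the top edge, and `cap i` joins the points `i + 1`
and `i + 2` on the bottom edge; all other points are joined by through strands. -/
inductive Elementary : Type
  | cup (i : ℕ)
  | cap (i : ℕ)

open FreeAlgebra in
/-- Planar isotopy of composites of elementary diagrams (in a product, the left factor is on top),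
together with the removal of a closed circle at the cost of the factor `δ`. -/
inductive Isotopy (δ : ℂ) : FreeAlgebra ℂ Elementary → FreeAlgebra ℂ Elementary → Prop
  | circle (i : ℕ) : Isotopy δ (ι ℂ (.cap i) * ι ℂ (.cup i)) (algebraMap ℂ _ δ)
  | zigzag (i : ℕ) : Isotopy δ (ι ℂ (.cap i) * ι ℂ (.cup (i + 1))) 1
  | zagzig (i : ℕ) : Isotopy δ (ι ℂ (.cap (i + 1)) * ι ℂ (.cup i)) 1
  | cap_cup (i j : ℕ) (h : i ≤ j) :
      Isotopy δ (ι ℂ (.cap i) * ι ℂ (.cup (j + 2))) (ι ℂ (.cup j) * ι ℂ (.cap i))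
  | cap_cup' (i j : ℕ) (h : i ≤ j) :
      Isotopy δ (ι ℂ (.cap (j + 2)) * ι ℂ (.cup i)) (ι ℂ (.cup i) * ι ℂ (.cap j))
  | cup_cup (i j : ℕ) (h : i ≤ j) :
      Isotopy δ (ι ℂ (.cup i) * ι ℂ (.cup j)) (ι ℂ (.cup (j + 2)) * ι ℂ (.cup i))
  | cap_cap (i j : ℕ) (h : i ≤ j) :
      Isotopy δ (ι ℂ (.cap j) * ι ℂ (.cap i)) (ι ℂ (.cap i) * ι ℂ (.cap (j + 2)))

/-- The algebra of planar diagrams with loop value `δ` on the strands `1, 2, 3, …`.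
A diagram with `n` points on top and `k` points at the bottom is regarded as an element of this
algebra by adding vertical strands on its right, so a diagram `x` and `x ⊗ 1` are the same
element, as they are under the inclusions `TL_n ⊂ TL_{n+1}`. -/
abbrev Diagrams (δ : ℂ) : Type := RingQuot (Isotopy δ)

/-- The cup on the top points `i + 1` and `i + 2`. -/
def cup (δ : ℂ) (i : ℕ) : Diagrams δ := RingQuot.mkAlgHom ℂ (Isotopy δ) (FreeAlgebra.ι ℂ (.cup i))

/-- The cap on the bottom points `i + 1` and `i + 2`. -/
def cap (δ : ℂ) (i : ℕ) : Diagrams δ := RingQuot.mkAlgHom ℂ (Isotopy δ) (FreeAlgebra.ι ℂ (.cap i))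

theorem mk_eq {δ : ℂ} {x y : FreeAlgebra ℂ Elementary} (h : Isotopy δ x y) :
    RingQuot.mkAlgHom ℂ (Isotopy δ) x = RingQuot.mkAlgHom ℂ (Isotopy δ) y :=
  RingQuot.mkAlgHom_rel ℂ h

/-- Reflection of elementary diagrams about the horizontal axis. -/
def Elementary.reflect (δ : ℂ) : Elementary → (Diagrams δ)ᵐᵒᵖ
  | .cup i => .op (TemperleyLieb.cap δ i)
  | .cap i => .op (TemperleyLieb.cup δ i)

/-- The reflection `†`, as an algebra homomorphism to the opposite algebra. -/
def reflectHom (δ : ℂ) : Diagrams δ →ₐ[ℂ] (Diagrams δ)ᵐᵒᵖ :=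
  RingQuot.liftAlgHom ℂ ⟨FreeAlgebra.lift ℂ (Elementary.reflect δ), by
    intro x y h
    apply MulOpposite.unop_injective
    cases h with
    | circle i =>
      simpa [Elementary.reflect, cup, cap] using mk_eq (Isotopy.circle (δ := δ) i)
    | zigzag i =>
      simpa [Elementary.reflect, cup, cap] using mk_eq (Isotopy.zagzig (δ := δ) i)
    | zagzig i =>
      simpa [Elementary.reflect, cup, cap] using mk_eq (Isotopy.zigzag (δ := δ) i)
    | cap_cup i j h =>
      simpa [Elementary.reflect, cup, cap] using mk_eq (Isotopy.cap_cup' (δ := δ) i j h)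
    | cap_cup' i j h =>
      simpa [Elementary.reflect, cup, cap] using mk_eq (Isotopy.cap_cup (δ := δ) i j h)
    | cup_cup i j h =>
      simpa [Elementary.reflect, cup, cap] using mk_eq (Isotopy.cap_cap (δ := δ) i j h)
    | cap_cap i j h =>
      simpa [Elementary.reflect, cup, cap] using mk_eq (Isotopy.cup_cup (δ := δ) i j h)⟩

/-- The linear anti-automorphism `†`, reflecting diagrams about the horizontal axis. -/
def dagger {δ : ℂ} (x : Diagrams δ) : Diagrams δ := (reflectHom δ x).unop

/-! ## The Temperley-Lieb algebras -/

/-- The generator `e_i` for `i ≥ 1`: a cup and a cap on the points `i` and `i + 1`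
(there is no `e_0`; the value `0` is a placeholder). -/
def e (δ : ℂ) : ℕ → Diagrams δ
  | 0 => 0
  | i + 1 => cup δ i * cap δ i

/-- `TL_n(δ)`, generated by `e_1, …, e_{n-1}`. -/
def TL (δ : ℂ) (n : ℕ) : Subalgebra ℂ (Diagrams δ) :=
  Algebra.adjoin ℂ {x | ∃ i, 1 ≤ i ∧ i + 1 ≤ n ∧ x = e δ i}

/-- `TL_∞(δ)`, the union of the algebras `TL_n(δ)`, generated by all `e_i`. -/
def TLInf (δ : ℂ) : Subalgebra ℂ (Diagrams δ) :=
  Algebra.adjoin ℂ {x | ∃ i, 1 ≤ i ∧ x = e δ i}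

theorem e_mem (δ : ℂ) (i : ℕ) : e δ i ∈ TLInf δ := by
  cases i with
  | zero => exact zero_mem _
  | succ i => exact Algebra.subset_adjoin ⟨i + 1, by omega, rfl⟩

/-- The generator `e_i`, as an element of `TL_∞(δ)`. -/
def gen (δ : ℂ) (i : ℕ) : TLInf δ := ⟨e δ i, e_mem δ i⟩

/-- `f` is the Jones-Wenzl idempotent of `TL_n(δ)`: the (unique) non-zero idempotent of `TL_n(δ)`
that is annihilated on both sides by `e_1, …, e_{n-1}`. -/
structure IsJonesWenzl (δ : ℂ) (n : ℕ) (f : Diagrams δ) : Prop where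
  mem : f ∈ TL δ n
  idem : f * f = f
  ne_zero : f ≠ 0
  e_mul : ∀ i, 1 ≤ i → i + 1 ≤ n → e δ i * f = 0
  mul_e : ∀ i, 1 ≤ i → i + 1 ≤ n → f * e δ i = 0

open Classical in
/-- The Jones-Wenzl idempotent `f_n` (with value `0` where it does not exist). At `δ = 0` it exists
for `n` odd, and is only used there. -/
def jonesWenzl (δ : ℂ) (n : ℕ) : Diagrams δ :=
  if h : ∃ f, IsJonesWenzl δ n f then h.choose else 0

/-! ## Fusion rules and matrix units at `δ = 0` -/

/-- The Jones-Wenzl idempotent `f_{2j+1}` at `δ = 0`. -/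
def f (j : ℕ) : Diagrams 0 := jonesWenzl 0 (2 * j + 1)

/-- With `k = 2j+1`: the half diagram from `k` to `k + 2` points consisting of `f_k` and of a cup on
the points `k + 1` and `k + 2`. -/
def outerCup (j : ℕ) : Diagrams 0 := f j * cup 0 (2 * j + 1)

/-- With `k = 2j+1`: the half diagram from `k` to `k + 2` points consisting of `f_k`, of a cup on the
points `k` and `k + 1`, and of `f_k` again. -/
def innerCup (j : ℕ) : Diagrams 0 := f j * cup 0 (2 * j) * f j

/-- With `k = 2j+3`: the half diagram from `k - 2` to `k + 2` points consisting of `f_k`, of two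
nested cups on the points `k - 1, k, k + 1, k + 2`, and of `f_{k-2}`. -/
def nestedCups (j : ℕ) : Diagrams 0 := f (j + 1) * cup 0 (2 * j + 2) * cup 0 (2 * j + 1) * f j

/-- Paths on the Bratteli diagram of `TL_∞(0)` from the vertex with `1` strand on level `1` to the
vertex with `2j + 1` through strands on level `2m + 1`. The steps from an odd level to the next even
level are unique and are not recorded. From the even level to the next odd one there is one edge
that increases the number of through strands by `2`, a double edge that preserves it, and one edge
that decreases it by `2`. -/
inductive FusionPath : ℕ → ℕ → Type
  | start : FusionPath 0 0
  | up {m j : ℕ} (p : FusionPath m j) : FusionPath (m + 1) (j + 1)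
  | plus {m j : ℕ} (p : FusionPath m j) : FusionPath (m + 1) j
  | minus {m j : ℕ} (p : FusionPath m j) : FusionPath (m + 1) j
  | down {m j : ℕ} (p : FusionPath m (j + 1)) : FusionPath (m + 1) j

theorem FusionPath.finite : ∀ m j : ℕ, Finite (FusionPath m j)
  | 0, 0 => Finite.of_surjective (fun _ : Unit => FusionPath.start) fun p => by
      cases p; exact ⟨(), rfl⟩
  | 0, j + 1 =>
      haveI : IsEmpty (FusionPath 0 (j + 1)) := ⟨fun p => nomatch p⟩
      inferInstance
  | m + 1, 0 => by
      have h₀ := FusionPath.finite m 0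
      have h₁ := FusionPath.finite m 1
      refine Finite.of_surjective (α := FusionPath m 0 ⊕ FusionPath m 0 ⊕ FusionPath m 1)
        (Sum.elim .plus (Sum.elim .minus .down)) fun p => ?_
      cases p with
      | plus p => exact ⟨.inl p, rfl⟩
      | minus p => exact ⟨.inr (.inl p), rfl⟩
      | down p => exact ⟨.inr (.inr p), rfl⟩
  | m + 1, j + 1 => by
      have h₀ := FusionPath.finite m j
      have h₁ := FusionPath.finite m (j + 1)
      have h₂ := FusionPath.finite m (j + 2)
      refine Finite.of_surjective
        (α := FusionPath m j ⊕ FusionPath m (j + 1) ⊕ FusionPath m (j + 1) ⊕ FusionPath m (j + 2))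
        (Sum.elim .up (Sum.elim .plus (Sum.elim .minus .down))) fun p => ?_
      cases p with
      | up p => exact ⟨.inl p, rfl⟩
      | plus p => exact ⟨.inr (.inl p), rfl⟩
      | minus p => exact ⟨.inr (.inr (.inl p)), rfl⟩
      | down p => exact ⟨.inr (.inr (.inr p)), rfl⟩

instance FusionPath.instFintype (m j : ℕ) : Fintype (FusionPath m j) :=
  haveI := FusionPath.finite m j
  Fintype.ofFinite _

/-- The half diagram `v_p`, with `2m + 1` points on top and `2j + 1` points at the bottom, obtained
by composing the fusion rules along the path `p`. They are normalized by `v_p† v_p = f_{2j+1}`. -/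
def halfDiagram : {m j : ℕ} → FusionPath m j → Diagrams 0
  | _, _, .start => 1
  | _, _, .up (j := j) p => halfDiagram p * f (j + 1)
  | _, _, .plus (j := j) p =>
      halfDiagram p * ((1 / (√2 : ℝ) : ℂ) • (outerCup j + innerCup j))
  | _, _, .minus (j := j) p =>
      halfDiagram p * ((Complex.I / (√2 : ℝ) : ℂ) • (outerCup j - innerCup j))
  | _, _, .down (j := j) p =>
      halfDiagram p * ((Complex.I * (√((j + 1 : ℝ) / (j + 2)) : ℝ) : ℂ) • nestedCups j)

/-- The matrix unit `v_{p,q} = v_p v_q†` of `TL_{2m+1}(0)`. -/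
def matrixUnit {m j : ℕ} (p q : FusionPath m j) : Diagrams 0 :=
  halfDiagram p * dagger (halfDiagram q)

/-- `D` is the corrected involution `◇` of `TL_∞(0)`: the conjugate linear, anti-multiplicative
involution that interchanges the matrix units `v_{p,q}` and `v_{q,p}`. -/
structure IsCorrectedInvolution (D : TLInf 0 →ₛₗ[starRingEnd ℂ] TLInf 0) : Prop where
  involutive : ∀ x, D (D x) = x
  map_mul : ∀ x y, D (x * y) = D y * D x
  matrixUnit : ∀ (m j : ℕ) (p q : FusionPath m j),
    ∃ h : matrixUnit p q ∈ TLInf 0, (D ⟨matrixUnit p q, h⟩ : Diagrams 0) = matrixUnit q p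

end

end TemperleyLieb

/-! Write `a`, `b`, `c` for the fusion half diagrams starting from `f_k` with `k = 2j + 1`
(`outerCup`, `innerCup`, and `scaledCups`, the last one rescaled). The two-strand recursion for
Jones–Wenzl idempotents says exactly that `f_k ⊗ 1_2 = f_{k+2} + a b† + b a† - c c†` (`f_eq_sum`).
For the bilinear pairing `x† y`, the half diagrams `a` and `b` form a hyperbolic pair, `c` has norm
`-1`, and all other pairings between `f_{k+2}`, `a`, `b`, `c` vanish. Hence the factors `1/√2` and
`i` in the fusion rules produce an orthonormal system; the `v_{p,q}` multiply as matrix units and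
the `v_{p,p}` sum to one (`sum_matrixUnit`). Of the inner products only their reality has to be
remembered (`gram_halfDiagram`).

The involution conjugates coordinates in this system. The coordinates of `a` and `b` are conjugate
to each other and that of `c` is imaginary, so the involution interchanges `a` with `b` and negates
`c` (`HalfConj.mul_outerCup`, `HalfConj.mul_scaledCups_succ`). Its graph on the span of one level is
`LevelAdjoint`. This relation passes to the next level, respects products, and is single valued
because no `f_j` vanishes (`LevelAdjoint.succ`, `LevelAdjoint.mul`, `LevelAdjoint.eq_zero`). It is
defined on all generators, hence on `TL_∞`; uniqueness follows because matrix units then span.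

On generators: `e_n` with `n ≥ 2` slides through the half diagrams of the appropriate level, so it
is a sum of terms `v_p e v_p†` with `e` next to `f_k`. For `n` even the term is `v_p a a† v_p†`,
which goes to `v_p b b† v_p†`. For `n` odd it is expanded along two further steps and conjugated
termwise (`HalfConj.mul_e_mul_dagger`). -/

namespace TemperleyLieb

noncomputable section

/-! ### Relations between cups and caps -/

section Relations

variable {δ : ℂ}

theorem cap_mul_cup (i : ℕ) : cap δ i * cup δ i = algebraMap ℂ _ δ := by
  simpa [cup, cap] using mk_eq (Isotopy.circle (δ := δ) i)

theorem cap_mul_cup_succ (i : ℕ) : cap δ i * cup δ (i + 1) = 1 := by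
  simpa [cup, cap] using mk_eq (Isotopy.zigzag (δ := δ) i)

theorem cap_succ_mul_cup (i : ℕ) : cap δ (i + 1) * cup δ i = 1 := by
  simpa [cup, cap] using mk_eq (Isotopy.zagzig (δ := δ) i)

theorem cap_mul_cup_of_le {i j : ℕ} (h : i ≤ j) :
    cap δ i * cup δ (j + 2) = cup δ j * cap δ i := by
  simpa [cup, cap] using mk_eq (Isotopy.cap_cup (δ := δ) i j h)

theorem cap_mul_cup_of_ge {i j : ℕ} (h : i ≤ j) :
    cap δ (j + 2) * cup δ i = cup δ i * cap δ j := by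
  simpa [cup, cap] using mk_eq (Isotopy.cap_cup' (δ := δ) i j h)

theorem cup_mul_cup {i j : ℕ} (h : i ≤ j) :
    cup δ i * cup δ j = cup δ (j + 2) * cup δ i := by
  simpa [cup, cap] using mk_eq (Isotopy.cup_cup (δ := δ) i j h)

theorem cap_mul_cap {i j : ℕ} (h : i ≤ j) :
    cap δ j * cap δ i = cap δ i * cap δ (j + 2) := by
  simpa [cup, cap] using mk_eq (Isotopy.cap_cap (δ := δ) i j h)

end Relations

/-! ### The reflection -/

section Dagger

variable {δ : ℂ}

@[simp] theorem dagger_mul (x y : Diagrams δ) : dagger (x * y) = dagger y * dagger x := by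
  simp [dagger]

@[simp] theorem dagger_add (x y : Diagrams δ) : dagger (x + y) = dagger x + dagger y := by
  simp [dagger]

@[simp] theorem dagger_sub (x y : Diagrams δ) : dagger (x - y) = dagger x - dagger y := by
  simp [dagger]

@[simp] theorem dagger_neg (x : Diagrams δ) : dagger (-x) = -dagger x := by
  simp [dagger]

@[simp] theorem dagger_smul (c : ℂ) (x : Diagrams δ) : dagger (c • x) = c • dagger x := by
  simp [dagger]

@[simp] theorem dagger_one : dagger (1 : Diagrams δ) = 1 := by simp [dagger]

@[simp] theorem dagger_zero : dagger (0 : Diagrams δ) = 0 := by simp [dagger]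

@[simp] theorem dagger_cup (i : ℕ) : dagger (cup δ i) = cap δ i := by
  simp [dagger, cup, reflectHom, Elementary.reflect]

@[simp] theorem dagger_cap (i : ℕ) : dagger (cap δ i) = cup δ i := by
  simp [dagger, cap, reflectHom, Elementary.reflect]

@[simp] theorem dagger_dagger (x : Diagrams δ) : dagger (dagger x) = x := by
  let T : Diagrams δ →ₐ[ℂ] Diagrams δ :=
    AlgHom.ofLinearMap
      { toFun := fun x => dagger (dagger x)
        map_add' := fun x y => by simp
        map_smul' := fun c x => by simp } (by simp) (fun x y => by simp)
  have hT : T = AlgHom.id ℂ _ := by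
    apply RingQuot.ringQuot_ext'
    ext y
    cases y with
    | cup i => exact (congrArg dagger (dagger_cup (δ := δ) i)).trans (dagger_cap i)
    | cap i => exact (congrArg dagger (dagger_cap (δ := δ) i)).trans (dagger_cup i)
  exact DFunLike.congr_fun hT x

@[simp] theorem dagger_e (i : ℕ) : dagger (e δ i) = e δ i := by
  cases i <;> simp [e]

end Dagger

/-! ### Balanced products of cups and caps lie in the Temperley–Lieb algebra -/

section Membership

variable {δ : ℂ}

theorem e_mem_TL {n i : ℕ} (h : i + 1 ≤ n) : e δ i ∈ TL δ n := by
  cases i with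
  | zero => exact zero_mem _
  | succ i => exact Algebra.subset_adjoin ⟨i + 1, by omega, h, rfl⟩

theorem TL_mono {n k : ℕ} (h : n ≤ k) : TL δ n ≤ TL δ k := by
  refine Algebra.adjoin_le ?_
  rintro _ ⟨i, -, hi, rfl⟩
  exact e_mem_TL (hi.trans h)

theorem TL_le_TLInf (n : ℕ) : TL δ n ≤ TLInf δ := by
  refine Algebra.adjoin_le ?_
  rintro _ ⟨i, -, -, rfl⟩
  exact e_mem δ i

theorem exists_mem_TL {x : Diagrams δ} (hx : x ∈ TLInf δ) : ∃ n, x ∈ TL δ n := by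
  induction hx using Algebra.adjoin_induction with
  | mem x hx =>
    obtain ⟨i, -, rfl⟩ := hx
    exact ⟨i + 1, e_mem_TL le_rfl⟩
  | algebraMap c => exact ⟨0, Subalgebra.algebraMap_mem _ c⟩
  | add x y _ _ hx hy =>
    obtain ⟨n, hn⟩ := hx
    obtain ⟨k, hk⟩ := hy
    exact ⟨max n k, add_mem (TL_mono (le_max_left _ _) hn) (TL_mono (le_max_right _ _) hk)⟩
  | mul x y _ _ hx hy =>
    obtain ⟨n, hn⟩ := hx
    obtain ⟨k, hk⟩ := hy
    exact ⟨max n k, mul_mem (TL_mono (le_max_left _ _) hn) (TL_mono (le_max_right _ _) hk)⟩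

theorem dagger_mem_TLInf {x : Diagrams δ} (hx : x ∈ TLInf δ) : dagger x ∈ TLInf δ := by
  induction hx using Algebra.adjoin_induction with
  | mem x hx =>
    obtain ⟨i, -, rfl⟩ := hx
    simpa using e_mem δ i
  | algebraMap c =>
    rw [Algebra.algebraMap_eq_smul_one, dagger_smul, dagger_one]
    exact Subalgebra.smul_mem _ (one_mem _) c
  | add x y _ _ hx hy => simpa using add_mem hx hy
  | mul x y _ _ hx hy => simpa using mul_mem hy hx

theorem e_mul_cup {l i : ℕ} (h : l + 1 ≤ i) : e δ l * cup δ i = cup δ i * e δ l := by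
  cases l with
  | zero => simp [e]
  | succ l =>
    obtain ⟨i, rfl⟩ : ∃ k, i = k + 2 := ⟨i - 2, by omega⟩
    rw [e, mul_assoc, cap_mul_cup_of_le (by omega), ← mul_assoc, cup_mul_cup (by omega), mul_assoc]

/-- Elements of `TL_n` commute with cups to the right of the first `n` points. -/
theorem mul_cup_of_mem_TL {n i : ℕ} {x : Diagrams δ} (hx : x ∈ TL δ n) (h : n ≤ i) :
    x * cup δ i = cup δ i * x := by
  induction hx using Algebra.adjoin_induction with
  | mem x hx =>
    obtain ⟨l, -, hl, rfl⟩ := hx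
    exact e_mul_cup (hl.trans h)
  | algebraMap c => exact Algebra.commutes c _
  | add x y _ _ hx hy => rw [add_mul, mul_add, hx, hy]
  | mul x y _ _ hx hy => rw [mul_assoc, hy, ← mul_assoc, hx, mul_assoc]

theorem cap_mul_e {l i : ℕ} (h : l + 1 ≤ i) : cap δ i * e δ l = e δ l * cap δ i := by
  simpa using congrArg dagger (e_mul_cup (δ := δ) h)

/-- Elements of `TL_n` commute with caps to the right of the first `n` points. -/
theorem cap_mul_of_mem_TL {n i : ℕ} {x : Diagrams δ} (hx : x ∈ TL δ n) (h : n ≤ i) :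
    cap δ i * x = x * cap δ i := by
  induction hx using Algebra.adjoin_induction with
  | mem x hx =>
    obtain ⟨l, -, hl, rfl⟩ := hx
    exact cap_mul_e (hl.trans h)
  | algebraMap c => exact (Algebra.commutes c _).symm
  | add x y _ _ hx hy => rw [add_mul, mul_add, hx, hy]
  | mul x y _ _ hx hy => rw [← mul_assoc, hx, mul_assoc, hy, mul_assoc]

/-- A zigzag slides a cup one place to the right at the cost of a generator on its left. -/
theorem cup_eq_e_mul (i : ℕ) : cup δ i = e δ (i + 1) * cup δ (i + 1) := by
  rw [e, mul_assoc, cap_mul_cup_succ, mul_one]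

theorem exists_cup_eq (i k : ℕ) : ∃ w ∈ TLInf δ, cup δ i = w * cup δ (i + k) := by
  induction k with
  | zero => exact ⟨1, one_mem _, by simp⟩
  | succ k ih =>
    obtain ⟨w, hw, h⟩ := ih
    refine ⟨w * e δ (i + k + 1), mul_mem hw (e_mem _ _), ?_⟩
    rw [h, cup_eq_e_mul (i + k), mul_assoc, add_assoc]

/-- Slide the cup and the cap to a common position to the right of the support of `x`. There the cup
commutes with `x`, and cup times cap is a generator. -/
theorem cup_mul_mul_cap_mem {x : Diagrams δ} (hx : x ∈ TLInf δ) (i k : ℕ) :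
    cup δ i * x * cap δ k ∈ TLInf δ := by
  obtain ⟨n, hn⟩ := exists_mem_TL hx
  obtain ⟨w, hw, h⟩ := exists_cup_eq (δ := δ) i (k + n)
  obtain ⟨w', hw', h'⟩ := exists_cup_eq (δ := δ) k (i + n)
  have h'' := congrArg dagger h'
  rw [dagger_mul, dagger_cup, dagger_cup] at h''
  rw [h, h'', mul_assoc w, ← mul_cup_of_mem_TL hn (by omega),
    show i + (k + n) = k + (i + n) by omega]
  have := mul_mem (mul_mem (mul_mem hw hx) (e_mem δ (k + (i + n) + 1))) (dagger_mem_TLInf hw')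
  simpa only [e, mul_assoc] using this

/-- Linear combinations of products of elements of `TL_∞` and of `r` cups. -/
inductive IsHalf : ℕ → Diagrams δ → Prop
  | tl {x} (hx : x ∈ TLInf δ) : IsHalf 0 x
  | cup {r x t} (hx : IsHalf r x) (ht : t ∈ TLInf δ) (i : ℕ) : IsHalf (r + 1) (x * cup δ i * t)
  | add {r x y} (hx : IsHalf r x) (hy : IsHalf r y) : IsHalf r (x + y)
  | smul {r x} (c : ℂ) (hx : IsHalf r x) : IsHalf r (c • x)

theorem IsHalf.mul {r : ℕ} {x t : Diagrams δ} (hx : IsHalf r x) (ht : t ∈ TLInf δ) :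
    IsHalf r (x * t) := by
  induction hx with
  | tl hx => exact .tl (mul_mem hx ht)
  | cup hx hs i _ => simpa only [mul_assoc] using IsHalf.cup hx (mul_mem hs ht) i
  | add _ _ hx hy => rw [add_mul]; exact hx.add hy
  | smul c _ hx => rw [smul_mul_assoc]; exact hx.smul c

theorem IsHalf.mul_cup {r : ℕ} {x : Diagrams δ} (hx : IsHalf r x) (i : ℕ) :
    IsHalf (r + 1) (x * TemperleyLieb.cup δ i) := by
  simpa using IsHalf.cup hx (one_mem _) i

/-- With equally many cups on both sides, the innermost cup and cap can be absorbed into `t` and the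
induction continues; this is why `t` is kept general. -/
theorem IsHalf.mul_mul_dagger_mem {r : ℕ} {x y : Diagrams δ} (hx : IsHalf r x) (hy : IsHalf r y) :
    ∀ {t}, t ∈ TLInf δ → x * t * dagger y ∈ TLInf δ := by
  induction hx generalizing y with
  | tl hx =>
    intro t ht
    generalize hr : 0 = r at hy
    induction hy with
    | tl hy => exact mul_mem (mul_mem hx ht) (dagger_mem_TLInf hy)
    | cup => omega
    | add _ _ h h' => rw [dagger_add, mul_add]; exact add_mem (h hr) (h' hr)
    | smul c _ h => rw [dagger_smul, mul_smul_comm]; exact Subalgebra.smul_mem _ (h hr) c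
  | @cup r x s hx hs i ih =>
    intro t ht
    generalize hr : r + 1 = r' at hy
    induction hy with
    | tl => omega
    | @cup r' y s' hy hs' i' _ =>
      obtain rfl : r = r' := by omega
      have := ih hy (cup_mul_mul_cap_mem (mul_mem (mul_mem hs ht) (dagger_mem_TLInf hs')) i i')
      simpa only [mul_assoc, dagger_mul, dagger_cup] using this
    | add _ _ h h' => rw [dagger_add, mul_add]; exact add_mem (h hr) (h' hr)
    | smul c _ h => rw [dagger_smul, mul_smul_comm]; exact Subalgebra.smul_mem _ (h hr) c
  | add _ _ h h' => intro t ht; rw [add_mul, add_mul]; exact add_mem (h hy ht) (h' hy ht)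
  | smul c _ h =>
    intro t ht
    rw [smul_mul_assoc, smul_mul_assoc]
    exact Subalgebra.smul_mem _ (h hy ht) c

theorem IsHalf.mul_dagger_mem {r : ℕ} {x y : Diagrams δ} (hx : IsHalf r x) (hy : IsHalf r y) :
    x * dagger y ∈ TLInf δ := by
  simpa using hx.mul_mul_dagger_mem hy (one_mem _)

end Membership

/-! ### The diagram algebra is not zero -/

section Nontrivial

/-- Insert the letters `a` and `b` at the positions `i` and `i + 1` of a word. -/
def insertTwo (i : ℕ) (a b : Bool) (w : ℕ → Bool) (n : ℕ) : Bool :=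
  if n < i then w n else if n = i then a else if n = i + 1 then b else w (n - 2)

/-- Delete the letters at the positions `i` and `i + 1` of a word. -/
def deleteTwo (i : ℕ) (w : ℕ → Bool) (n : ℕ) : Bool := if n < i then w n else w (n + 2)

/-- The coefficient of two letters in the copairing. -/
def copairing (a b : Bool) : ℂ := if a = b then 0 else if a then 1 else -Complex.I

/-- The action of a cup on functions of words. -/
def cupEnd (i : ℕ) : Module.End ℂ ((ℕ → Bool) → ℂ) where
  toFun φ w := copairing (w i) (w (i + 1)) * φ (deleteTwo i w)
  map_add' φ ψ := by ext w; simp [mul_add]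
  map_smul' c φ := by ext w; simp; ring

/-- The action of a cap on functions of words. -/
def capEnd (i : ℕ) : Module.End ℂ ((ℕ → Bool) → ℂ) where
  toFun φ w := φ (insertTwo i false true w) + Complex.I * φ (insertTwo i true false w)
  map_add' φ ψ := by ext w; simp; ring
  map_smul' c φ := by ext w; simp; ring

theorem deleteTwo_insertTwo (i : ℕ) (a b : Bool) (w : ℕ → Bool) :
    deleteTwo i (insertTwo i a b w) = w := by
  ext n; grind [insertTwo, deleteTwo]

theorem deleteTwo_succ_insertTwo (i : ℕ) (a b : Bool) (w : ℕ → Bool) (h : w i = a) :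
    deleteTwo (i + 1) (insertTwo i a b w) = w := by
  ext n; grind [insertTwo, deleteTwo]

theorem deleteTwo_insertTwo_succ (i : ℕ) (a b : Bool) (w : ℕ → Bool) (h : w i = b) :
    deleteTwo i (insertTwo (i + 1) a b w) = w := by
  ext n; grind [insertTwo, deleteTwo]

/-- The representation of the diagrams with loop value `0` on functions of words in two letters. -/
def wordRep : Diagrams 0 →ₐ[ℂ] Module.End ℂ ((ℕ → Bool) → ℂ) :=
  RingQuot.liftAlgHom ℂ ⟨FreeAlgebra.lift ℂ fun
    | .cup i => cupEnd i
    | .cap i => capEnd i, by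
    intro x y h
    cases h with
    | circle i =>
      ext φ w
      -- The two words contribute `-i` and `i` to the circle, which cancel: the loop value is zero.
      simp [cupEnd, capEnd, deleteTwo_insertTwo]
      simp [insertTwo, copairing]
    | zigzag i =>
      ext φ w
      have h₀ : ¬ i + 1 + 1 < i ∧ ¬ i + 1 + 1 = i := by omega
      simp [cupEnd, capEnd]
      cases h : w i
      · simp [deleteTwo_succ_insertTwo _ _ _ _ h]
        simp [insertTwo, copairing, h, h₀]
      · simp [deleteTwo_succ_insertTwo _ _ _ _ h]
        simp [insertTwo, copairing, h, h₀, ← mul_assoc]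
    | zagzig i =>
      ext φ w
      simp [cupEnd, capEnd]
      cases h : w i
      · simp [deleteTwo_insertTwo_succ _ _ _ _ h]
        simp [insertTwo, copairing, h, ← mul_assoc]
      · simp [deleteTwo_insertTwo_succ _ _ _ _ h]
        simp [insertTwo, copairing, h]
    | cap_cup i j h =>
      ext φ w
      have h₁ (a b) : deleteTwo (j + 2) (insertTwo i a b w) = insertTwo i a b (deleteTwo j w) := by
        ext n; grind [insertTwo, deleteTwo]
      have h₂ (a b) : insertTwo i a b w (j + 2) = w j := by grind [insertTwo]
      have h₃ (a b) : insertTwo i a b w (j + 2 + 1) = w (j + 1) := by grind [insertTwo]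
      simp [cupEnd, capEnd, h₁, h₂, h₃]
      ring
    | cap_cup' i j h =>
      ext φ w
      have h₁ (a b) : deleteTwo i (insertTwo (j + 2) a b w) = insertTwo j a b (deleteTwo i w) := by
        ext n; grind [insertTwo, deleteTwo]
      have h₂ (a b) : insertTwo (j + 2) a b w i = w i := by grind [insertTwo]
      have h₃ (a b) : insertTwo (j + 2) a b w (i + 1) = w (i + 1) := by grind [insertTwo]
      simp [cupEnd, capEnd, h₁, h₂, h₃]
      ring
    | cup_cup i j h =>
      ext φ w
      have h₁ : deleteTwo j (deleteTwo i w) = deleteTwo i (deleteTwo (j + 2) w) := by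
        ext n; grind [deleteTwo]
      have h₂ : deleteTwo i w j = w (j + 2) := by grind [deleteTwo]
      have h₃ : deleteTwo i w (j + 1) = w (j + 2 + 1) := by grind [deleteTwo]
      have h₄ : deleteTwo (j + 2) w i = w i := by grind [deleteTwo]
      have h₅ : deleteTwo (j + 2) w (i + 1) = w (i + 1) := by grind [deleteTwo]
      simp [cupEnd, h₁, h₂, h₃, h₄, h₅]
      ring
    | cap_cap i j h =>
      ext φ w
      have h₁ (a b c d) : insertTwo i a b (insertTwo j c d w) =
          insertTwo (j + 2) c d (insertTwo i a b w) := by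
        ext n; by_cases hn : j + 4 ≤ n <;> grind [insertTwo]
      simp [capEnd, h₁]
      ring⟩

/-- An algebra given by generators and relations might collapse; the representation on words
excludes this. It is the source of all later nonvanishing statements. -/
theorem one_ne_zero_diagrams : (1 : Diagrams 0) ≠ 0 := by
  intro h
  have := congrArg wordRep h
  rw [map_one, map_zero] at this
  exact one_ne_zero this

end Nontrivial

/-! ### Rewriting rules for right-associated products -/

section Reassoc

/-- With a free factor on the right, every pair of adjacent factors in a right-associated product
has a tail, so the rules in `_assoc` form apply everywhere. -/
theorem eq_of_forall_mul {x y : Diagrams 0} (h : ∀ z, x * z = y * z) : x = y := by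
  simpa using h 1

theorem cap_cup_assoc (i : ℕ) (z : Diagrams 0) : cap 0 i * (cup 0 i * z) = 0 := by
  rw [← mul_assoc, cap_mul_cup, map_zero, zero_mul]

theorem cap_cup_succ_assoc {i k : ℕ} (h : k = i + 1) (z : Diagrams 0) :
    cap 0 i * (cup 0 k * z) = z := by
  rw [h, ← mul_assoc, cap_mul_cup_succ, one_mul]

theorem cap_succ_cup_assoc {i k : ℕ} (h : k = i + 1) (z : Diagrams 0) :
    cap 0 k * (cup 0 i * z) = z := by
  rw [h, ← mul_assoc, cap_succ_mul_cup, one_mul]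

theorem cap_cup_far_assoc {i k : ℕ} (h : i + 2 ≤ k) (z : Diagrams 0) :
    cap 0 i * (cup 0 k * z) = cup 0 (k - 2) * (cap 0 i * z) := by
  obtain ⟨k, rfl⟩ : ∃ l, k = l + 2 := ⟨k - 2, by omega⟩
  rw [← mul_assoc, cap_mul_cup_of_le (by omega), mul_assoc, Nat.add_sub_cancel]

theorem cap_far_cup_assoc {i k : ℕ} (h : i + 2 ≤ k) (z : Diagrams 0) :
    cap 0 k * (cup 0 i * z) = cup 0 i * (cap 0 (k - 2) * z) := by
  obtain ⟨k, rfl⟩ : ∃ l, k = l + 2 := ⟨k - 2, by omega⟩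
  rw [← mul_assoc, cap_mul_cup_of_ge (by omega), mul_assoc, Nat.add_sub_cancel]

theorem cup_cup_assoc {i k : ℕ} (h : i ≤ k) (z : Diagrams 0) :
    cup 0 i * (cup 0 k * z) = cup 0 (k + 2) * (cup 0 i * z) := by
  rw [← mul_assoc, cup_mul_cup h, mul_assoc]

theorem cap_cap_assoc {i k : ℕ} (h : i ≤ k) (z : Diagrams 0) :
    cap 0 k * (cap 0 i * z) = cap 0 i * (cap 0 (k + 2) * z) := by
  rw [← mul_assoc, cap_mul_cap h, mul_assoc]

end Reassoc

/-! ### Construction of the Jones–Wenzl idempotents on odd numbers of strands -/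

/-- The properties that characterize the Jones-Wenzl idempotent of `TL_{n+1}(0)`. -/
structure IsProjector (n : ℕ) (F : Diagrams 0) : Prop where
  mem : F ∈ TL 0 (n + 1)
  dagger_eq : dagger F = F
  mul_cup : ∀ i < n, F * cup 0 i = 0
  absorb : ∀ g, (∀ i < n, g * cup 0 i = 0) → g * F = g

namespace IsProjector

variable {n : ℕ} {F : Diagrams 0} (hF : IsProjector n F)

include hF

theorem cap_mul (i : ℕ) (h : i < n) : cap 0 i * F = 0 := by
  simpa [hF.dagger_eq] using congrArg dagger (hF.mul_cup i h)

theorem mul_self : F * F = F := hF.absorb F hF.mul_cup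

theorem mul_self_assoc (z : Diagrams 0) : F * (F * z) = F * z := by
  rw [← mul_assoc, hF.mul_self]

theorem mul_cup_assoc {i : ℕ} (h : i < n) (z : Diagrams 0) : F * (cup 0 i * z) = 0 := by
  rw [← mul_assoc, hF.mul_cup i h, zero_mul]

theorem cap_mul_assoc {i : ℕ} (h : i < n) (z : Diagrams 0) : cap 0 i * (F * z) = 0 := by
  rw [← mul_assoc, hF.cap_mul i h, zero_mul]

theorem comm_cup_assoc {i : ℕ} (h : n + 1 ≤ i) (z : Diagrams 0) :
    F * (cup 0 i * z) = cup 0 i * (F * z) := by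
  rw [← mul_assoc, mul_cup_of_mem_TL hF.mem h, mul_assoc]

theorem comm_cap_assoc {i : ℕ} (h : n + 1 ≤ i) (z : Diagrams 0) :
    cap 0 i * (F * z) = F * (cap 0 i * z) := by
  rw [← mul_assoc, cap_mul_of_mem_TL hF.mem h, mul_assoc]

end IsProjector

theorem IsProjector.mul_assoc_of_le {n k : ℕ} {F G : Diagrams 0} (hF : IsProjector n F)
    (hG : IsProjector k G) (h : k ≤ n) (z : Diagrams 0) : F * (G * z) = F * z := by
  rw [← mul_assoc, hG.absorb F fun i hi => hF.mul_cup i (by omega)]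

theorem IsProjector.mul_assoc_of_ge {n k : ℕ} {F G : Diagrams 0} (hF : IsProjector n F)
    (hG : IsProjector k G) (h : k ≤ n) (z : Diagrams 0) : G * (F * z) = F * z := by
  have : G * F = F := by
    simpa [hF.dagger_eq, hG.dagger_eq] using
      congrArg dagger (hG.absorb F fun i hi => hF.mul_cup i (by omega))
  rw [← mul_assoc, this]

/-- The recursion for the Jones-Wenzl idempotents with an odd number of strands. -/
def jwStep (j : ℕ) (F : Diagrams 0) : Diagrams 0 :=
  F - F * cup 0 (2 * j + 1) * cap 0 (2 * j) * F - F * cup 0 (2 * j) * cap 0 (2 * j + 1) * F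
    -- The coefficient vanishes at `j = 0`, where the index `2 * j - 1` is truncated.
    + (j / (j + 1) : ℂ) •
      (F * cup 0 (2 * j) * cup 0 (2 * j - 1) * cap 0 (2 * j - 1) * cap 0 (2 * j) * F)

/-- The Jones-Wenzl idempotents with `2j + 1` strands. -/
def jw : ℕ → Diagrams 0
  | 0 => 1
  | j + 1 => jwStep j (jw j)

theorem jwStep_mul_assoc (j : ℕ) (F z : Diagrams 0) : jwStep j F * z = F * z
    - F * (cup 0 (2 * j + 1) * (cap 0 (2 * j) * (F * z)))
    - F * (cup 0 (2 * j) * (cap 0 (2 * j + 1) * (F * z)))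
    + (j / (j + 1) : ℂ) • (F * (cup 0 (2 * j) * (cup 0 (2 * j - 1) *
        (cap 0 (2 * j - 1) * (cap 0 (2 * j) * (F * z)))))) := by
  simp only [jwStep, add_mul, sub_mul, smul_mul_assoc, mul_assoc]

theorem dagger_jwStep (j : ℕ) {F : Diagrams 0} (h : dagger F = F) :
    dagger (jwStep j F) = jwStep j F := by
  simp only [jwStep, dagger_add, dagger_sub, dagger_smul, dagger_mul, dagger_cup, dagger_cap, h,
    mul_assoc]
  abel

theorem jwStep_mem (j : ℕ) {F : Diagrams 0} (h : F ∈ TL 0 (2 * j + 1)) :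
    jwStep j F ∈ TL 0 (2 * j + 3) := by
  have hF := TL_mono (show 2 * j + 1 ≤ 2 * j + 3 by omega) h
  have h₁ : cup 0 (2 * j + 1) * cap 0 (2 * j) = e 0 (2 * j + 2) * e 0 (2 * j + 1) := by
    apply eq_of_forall_mul
    intro z
    simp only [e, mul_assoc, cap_succ_cup_assoc rfl]
  have h₂ : cup 0 (2 * j) * cap 0 (2 * j + 1) = e 0 (2 * j + 1) * e 0 (2 * j + 2) := by
    apply eq_of_forall_mul
    intro z
    simp only [e, mul_assoc, cap_cup_succ_assoc rfl]
  have hm₁ : e 0 (2 * j + 1) ∈ TL 0 (2 * j + 3) := e_mem_TL (by omega)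
  have hm₂ : e 0 (2 * j + 2) ∈ TL 0 (2 * j + 3) := e_mem_TL (by omega)
  have hn : (j / (j + 1) : ℂ) •
      (F * cup 0 (2 * j) * cup 0 (2 * j - 1) * cap 0 (2 * j - 1) * cap 0 (2 * j) * F)
      ∈ TL 0 (2 * j + 3) := by
    cases j with
    | zero => simp
    | succ i =>
      have h₃ : cup 0 (2 * (i + 1)) * cup 0 (2 * (i + 1) - 1) * cap 0 (2 * (i + 1) - 1) *
          cap 0 (2 * (i + 1)) =
          e 0 (2 * i + 3) * e 0 (2 * i + 2) * e 0 (2 * i + 4) * e 0 (2 * i + 3) := by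
        apply eq_of_forall_mul
        intro z
        simp (disch := omega) only [e, mul_assoc, show 2 * (i + 1) = 2 * i + 2 by ring,
          show 2 * i + 2 - 1 = 2 * i + 1 by omega, cap_succ_cup_assoc, cap_cup_far_assoc,
          show 2 * i + 3 - 2 = 2 * i + 1 by omega]
      have := mul_mem (mul_mem hF (mul_mem (mul_mem (mul_mem
        (e_mem_TL (δ := 0) (show 2 * i + 3 + 1 ≤ 2 * (i + 1) + 3 by omega))
        (e_mem_TL (δ := 0) (show 2 * i + 2 + 1 ≤ 2 * (i + 1) + 3 by omega)))
        (e_mem_TL (δ := 0) (show 2 * i + 4 + 1 ≤ 2 * (i + 1) + 3 by omega)))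
        (e_mem_TL (δ := 0) (show 2 * i + 3 + 1 ≤ 2 * (i + 1) + 3 by omega)))) hF
      rw [← h₃] at this
      simpa only [mul_assoc] using Subalgebra.smul_mem _ this _
  have h₄ := mul_mem (mul_mem hF (mul_mem hm₂ hm₁)) hF
  have h₅ := mul_mem (mul_mem hF (mul_mem hm₁ hm₂)) hF
  rw [← h₁] at h₄
  rw [← h₂] at h₅
  simp only [← mul_assoc] at h₄ h₅
  exact add_mem (sub_mem (sub_mem hF h₄) h₅) hn

/-- This closes up the last strand of the new projector. The leading term gives a circle, hence
zero; each of the other three gives a multiple of the same diagram, with coefficients `-1`, `-1` and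
`j / (j + 1)`. -/
theorem trace_jwStep (j : ℕ) {F : Diagrams 0} (hF : IsProjector (2 * j) F) (z : Diagrams 0) :
    cap 0 (2 * j + 2) * (jwStep j F * (cup 0 (2 * j + 2) * z)) =
      (-((j + 2) / (j + 1)) : ℂ) • (F * (cup 0 (2 * j) * (cap 0 (2 * j) * (F * z)))) := by
  have h : (-((j + 2) / (j + 1)) : ℂ) = -2 + j / (j + 1) := by
    have : (j + 1 : ℂ) ≠ 0 := by exact_mod_cast j.succ_ne_zero
    field_simp; ring
  rw [h, jwStep_mul_assoc, mul_add, mul_sub, mul_sub, mul_smul_comm]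
  simp (disch := omega) only [hF.comm_cup_assoc, hF.comm_cap_assoc, cap_cup_assoc,
    cap_succ_cup_assoc, cap_cup_succ_assoc, cap_cup_far_assoc, cap_far_cup_assoc,
    Nat.add_sub_cancel]
  rcases Nat.eq_zero_or_pos j with rfl | hj
  · simp only [Nat.cast_zero, zero_div, zero_smul]
    module
  simp (disch := omega) only [cap_succ_cup_assoc, cap_cup_succ_assoc]
  module

/-- A cup among the first points moves past `cup 0 n` and is killed by `G`. Of the four terms of the
recursion only the leading one and the one with `cup 0 (2 * j + 1)` escape. -/
theorem mul_cup_mul_jwStep {n j : ℕ} {F G : Diagrams 0} (hG : IsProjector n G)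
    (hn : n = 2 * j + 2) (hF : IsProjector (2 * j) F) (z : Diagrams 0) :
    G * (cup 0 n * (jwStep j F * z)) = G * (cup 0 n * z)
      - G * (cup 0 n * (cup 0 (2 * j + 1) * (cap 0 (2 * j) * (F * z)))) := by
  subst hn
  have h (i : ℕ) (h : i < 2 * j + 1) (y : Diagrams 0) :
      G * (cup 0 (2 * j + 2) * (cup 0 i * y)) = 0 := by
    rw [show 2 * j + 2 = (2 * j) + 2 by rfl, ← cup_cup_assoc (by omega),
      hG.mul_cup_assoc (by omega)]
  have h' (y : Diagrams 0) :
      G * (cup 0 (2 * j + 2) * (F * y)) = G * (cup 0 (2 * j + 2) * y) := by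
    rw [← hF.comm_cup_assoc (by omega), hG.mul_assoc_of_le hF (by omega)]
  rw [jwStep_mul_assoc]
  simp (disch := omega) only [mul_add, mul_sub, mul_smul_comm, h, h', smul_zero, sub_zero, add_zero]

/-- The properties of `jw j` that depend on `jw (j - 1)`. -/
structure IsTraceless (j : ℕ) (F : Diagrams 0) : Prop where
  cap_mul_mul_cup (z : Diagrams 0) :
    cap 0 (2 * j) * (F * (cup 0 (2 * j) * (F * z))) = 0
  mul_cup_mul_cap (z : Diagrams 0) :
    F * (cup 0 (2 * j + 1) * (cap 0 (2 * j) * (F * (cup 0 (2 * j) * z)))) = 0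
  mul_cup_eq (z : Diagrams 0) :
    (j / (j + 1) : ℂ) • (F * (cup 0 (2 * j) * (cup 0 (2 * j - 1) * (cap 0 (2 * j - 1) *
      (cap 0 (2 * j) * (F * (cup 0 (2 * j) * z))))))) =
        F * (cup 0 (2 * j) * (F * z)) - F * (cup 0 (2 * j) * z)

theorem isTraceless_one : IsTraceless 0 1 where
  cap_mul_mul_cup z := by simp only [one_mul, mul_zero, cap_cup_assoc]
  mul_cup_mul_cap z := by simp only [one_mul, mul_zero, cap_cup_assoc]
  mul_cup_eq z := by simp

/-- Each identity contains a partial trace of the new projector. By `trace_jwStep` it becomes a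
diagram in the smaller projector `H`, which the larger one absorbs. -/
theorem isTraceless_jwStep {j : ℕ} {H : Diagrams 0} (hH : IsProjector (2 * j) H)
    (hF : IsProjector (2 * (j + 1)) (jwStep j H)) : IsTraceless (j + 1) (jwStep j H) where
  cap_mul_mul_cup z := by
    rw [show 2 * (j + 1) = 2 * j + 2 by ring] at hF ⊢
    rw [trace_jwStep j hH, hF.mul_assoc_of_ge hH (by omega), hF.cap_mul_assoc (by omega)]
    simp only [mul_zero, smul_zero]
  mul_cup_mul_cap z := by
    rw [show 2 * (j + 1) = 2 * j + 2 by ring] at hF ⊢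
    rw [trace_jwStep j hH, mul_smul_comm, mul_smul_comm, ← hH.comm_cup_assoc (by omega),
      hF.mul_assoc_of_le hH (by omega), show 2 * j + 2 + 1 = (2 * j + 1) + 2 by ring,
      ← cup_cup_assoc (by omega), hF.mul_cup_assoc (by omega), smul_zero]
  mul_cup_eq z := by
    rw [show 2 * (j + 1) = 2 * j + 2 by ring] at hF ⊢
    -- The coefficient of the next recursion step is minus the inverse of the partial trace
    -- coefficient.
    have h₁ : (((j + 1 : ℕ) : ℂ) / ((j + 1 : ℕ) + 1)) * (-((j + 2) / (j + 1)) : ℂ) = -1 := by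
      have : (j + 1 : ℂ) ≠ 0 := by exact_mod_cast j.succ_ne_zero
      have : (j + 2 : ℂ) ≠ 0 := by exact_mod_cast (j + 1).succ_ne_zero
      have : (j + 1 + 1 : ℂ) ≠ 0 := by exact_mod_cast (j + 1).succ_ne_zero
      push_cast
      field_simp
      ring
    rw [mul_cup_mul_jwStep hF rfl hH, trace_jwStep j hH]
    simp only [mul_smul_comm, smul_smul, h₁]
    simp (disch := omega) only [show 2 * j + 2 - 1 = 2 * j + 1 by omega, hH.comm_cap_assoc,
      cap_succ_cup_assoc]
    have h₂ (y : Diagrams 0) : jwStep j H * (cup 0 (2 * j + 2) * (cup 0 (2 * j + 1) * (H * y))) =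
        jwStep j H * (cup 0 (2 * j + 2) * (cup 0 (2 * j + 1) * y)) := by
      rw [← hH.comm_cup_assoc (by omega), ← hH.comm_cup_assoc (by omega),
        hF.mul_assoc_of_le hH (by omega)]
    rw [h₂]
    module

theorem jwStep_isProjector {j : ℕ} {F : Diagrams 0} (hF : IsProjector (2 * j) F)
    (hF' : IsTraceless j F) : IsProjector (2 * (j + 1)) (jwStep j F) where
  mem := jwStep_mem j hF.mem
  dagger_eq := dagger_jwStep j hF.dagger_eq
  mul_cup i hi := by
    apply eq_of_forall_mul
    intro z
    rw [mul_assoc, jwStep_mul_assoc, zero_mul]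
    -- Cups inside `F` are killed by `F`; the cup at `2j` is the case that needs the trace
    -- identities; at `2j + 1` the first two terms cancel by a zigzag.
    obtain h | rfl | rfl : i < 2 * j ∨ i = 2 * j ∨ i = 2 * j + 1 := by omega
    · simp only [hF.mul_cup_assoc h, mul_zero, smul_zero, sub_zero, add_zero]
    · rw [hF'.mul_cup_mul_cap, hF'.mul_cup_eq]
      simp (disch := omega) only [hF.comm_cap_assoc, cap_succ_cup_assoc]
      module
    · simp (disch := omega) only [hF.comm_cup_assoc, cap_cup_succ_assoc, cap_cup_assoc,
        hF.mul_self_assoc, mul_zero, sub_self, zero_add]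
      rcases Nat.eq_zero_or_pos j with rfl | hj
      · simp
      · simp (disch := omega) only [hF.cap_mul_assoc, mul_zero, smul_zero]
  absorb g hg := by
    have h₁ : g * F = g := hF.absorb g fun i hi => hg i (by omega)
    have h₂ (z : Diagrams 0) : g * (F * z) = g * z := by rw [← mul_assoc, h₁]
    have h₃ (i : ℕ) (hi : i < 2 * (j + 1)) (z : Diagrams 0) : g * (cup 0 i * z) = 0 := by
      rw [← mul_assoc, hg i hi, zero_mul]
    apply eq_of_forall_mul
    intro z
    rw [mul_assoc, jwStep_mul_assoc]
    simp (disch := omega) only [mul_add, mul_sub, mul_smul_comm, h₂, h₃, smul_zero, sub_zero,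
      add_zero]

theorem isProjector_jw_and (j : ℕ) : IsProjector (2 * j) (jw j) ∧ IsTraceless j (jw j) := by
  induction j with
  | zero =>
    refine ⟨⟨one_mem _, dagger_one, fun i hi => by omega, fun g _ => mul_one g⟩, isTraceless_one⟩
  | succ j ih =>
    have h := jwStep_isProjector ih.1 ih.2
    exact ⟨h, isTraceless_jwStep ih.1 h⟩

theorem isProjector_jw (j : ℕ) : IsProjector (2 * j) (jw j) := (isProjector_jw_and j).1

theorem isTraceless_jw (j : ℕ) : IsTraceless j (jw j) := (isProjector_jw_and j).2

theorem jw_ne_zero (j : ℕ) : jw j ≠ 0 := by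
  induction j with
  | zero => exact one_ne_zero_diagrams
  | succ j ih =>
    intro h
    -- With this argument, and a further cap on the left, zigzags reduce the partial trace to a
    -- nonzero multiple of `jw j`.
    have h₁ := trace_jwStep j (isProjector_jw j) (cup 0 (2 * j + 1) * jw j)
    rw [← jw, h, zero_mul, mul_zero] at h₁
    have h₂ := congrArg (cap 0 (2 * j + 1) * ·) h₁.symm
    have hF := isProjector_jw j
    simp (disch := omega) only [mul_smul_comm, mul_zero, hF.comm_cap_assoc, hF.comm_cup_assoc,
      cap_cup_succ_assoc, cap_succ_cup_assoc, hF.mul_self] at h₂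
    have : (j + 1 : ℂ) ≠ 0 := by exact_mod_cast j.succ_ne_zero
    have : (j + 2 : ℂ) ≠ 0 := by exact_mod_cast (j + 1).succ_ne_zero
    have h₃ := smul_left_injective ℂ ih (h₂.trans (zero_smul ℂ _).symm)
    clear h₁ h₂ h
    simp_all

theorem isJonesWenzl_jw (j : ℕ) : IsJonesWenzl 0 (2 * j + 1) (jw j) where
  mem := (isProjector_jw j).mem
  idem := (isProjector_jw j).mul_self
  ne_zero := jw_ne_zero j
  e_mul i hi hi' := by
    obtain ⟨i, rfl⟩ : ∃ k, i = k + 1 := ⟨i - 1, by omega⟩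
    rw [e, mul_assoc, (isProjector_jw j).cap_mul i (by omega), mul_zero]
  mul_e i hi hi' := by
    obtain ⟨i, rfl⟩ : ∃ k, i = k + 1 := ⟨i - 1, by omega⟩
    rw [e, ← mul_assoc, (isProjector_jw j).mul_cup i (by omega), zero_mul]

theorem exists_mul_eq_smul {n : ℕ} {x F : Diagrams 0} (hx : x ∈ TL 0 n)
    (hF : ∀ i, 1 ≤ i → i + 1 ≤ n → e 0 i * F = 0) : ∃ c : ℂ, x * F = c • F := by
  induction hx using Algebra.adjoin_induction with
  | mem x hx =>
    obtain ⟨i, hi, hi', rfl⟩ := hx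
    exact ⟨0, by rw [hF i hi hi', zero_smul]⟩
  | algebraMap c => exact ⟨c, by rw [Algebra.algebraMap_eq_smul_one, smul_mul_assoc, one_mul]⟩
  | add x y _ _ hx hy =>
    obtain ⟨c, hc⟩ := hx
    obtain ⟨d, hd⟩ := hy
    exact ⟨c + d, by rw [add_mul, hc, hd, add_smul]⟩
  | mul x y _ _ hx hy =>
    obtain ⟨c, hc⟩ := hx
    obtain ⟨d, hd⟩ := hy
    exact ⟨d * c, by rw [mul_assoc, hd, mul_smul_comm, hc, smul_smul]⟩

/-- The product `g * jw j` equals `g` by absorption and a multiple of `jw j` because all generators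
kill `jw j`. A nonzero idempotent multiple has coefficient one. -/
theorem IsJonesWenzl.eq_jw {j : ℕ} {g : Diagrams 0} (hg : IsJonesWenzl 0 (2 * j + 1) g) :
    g = jw j := by
  obtain ⟨c, hc⟩ := exists_mul_eq_smul hg.mem (isJonesWenzl_jw j).e_mul
  have h : g * jw j = g := (isProjector_jw j).absorb g fun i hi => by
    rw [cup_eq_e_mul, ← mul_assoc, hg.mul_e (i + 1) (by omega) (by omega), zero_mul]
  rw [h] at hc
  have h₂ := hg.idem
  rw [hc, smul_mul_smul_comm, (isProjector_jw j).mul_self] at h₂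
  have h₃ := smul_left_injective ℂ (jw_ne_zero j) h₂
  have hc₀ : c ≠ 0 := by
    rintro rfl
    exact hg.ne_zero (by rw [hc, zero_smul])
  rw [hc, mul_left_cancel₀ hc₀ (h₃.trans (mul_one c).symm), one_smul]

theorem f_eq_jw (j : ℕ) : f j = jw j := by
  have h : ∃ g, IsJonesWenzl 0 (2 * j + 1) g := ⟨jw j, isJonesWenzl_jw j⟩
  rw [f, jonesWenzl, dif_pos h]
  exact h.choose_spec.eq_jw

/-! ### The fusion rules -/

section Steps

theorem isProjector_f (j : ℕ) : IsProjector (2 * j) (f j) := f_eq_jw j ▸ isProjector_jw j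

theorem isTraceless_f (j : ℕ) : IsTraceless j (f j) := f_eq_jw j ▸ isTraceless_jw j

theorem f_ne_zero (j : ℕ) : f j ≠ 0 := f_eq_jw j ▸ jw_ne_zero j

theorem f_zero : f 0 = 1 := f_eq_jw 0

theorem f_succ (j : ℕ) : f (j + 1) = jwStep j (f j) := by rw [f_eq_jw, f_eq_jw, jw]

theorem f_mem (j : ℕ) : f j ∈ TLInf 0 := TL_le_TLInf _ (isProjector_f j).mem

@[simp] theorem dagger_f (j : ℕ) : dagger (f j) = f j := (isProjector_f j).dagger_eq

@[simp] theorem f_mul_f (j : ℕ) : f j * f j = f j := (isProjector_f j).mul_self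

@[simp] theorem f_mul_f_assoc (j : ℕ) (z : Diagrams 0) : f j * (f j * z) = f j * z :=
  (isProjector_f j).mul_self_assoc z

theorem f_mul_f_of_le {i j : ℕ} (h : i ≤ j) (z : Diagrams 0) : f j * (f i * z) = f j * z :=
  (isProjector_f j).mul_assoc_of_le (isProjector_f i) (by omega) z

theorem f_mul_f_of_ge {i j : ℕ} (h : i ≤ j) (z : Diagrams 0) : f i * (f j * z) = f j * z :=
  (isProjector_f j).mul_assoc_of_ge (isProjector_f i) (by omega) z

theorem f_cup_zero {i j : ℕ} (h : i < 2 * j) (z : Diagrams 0) : f j * (cup 0 i * z) = 0 :=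
  (isProjector_f j).mul_cup_assoc h z

theorem cap_f_zero {i j : ℕ} (h : i < 2 * j) (z : Diagrams 0) : cap 0 i * (f j * z) = 0 :=
  (isProjector_f j).cap_mul_assoc h z

theorem f_cup_comm {i j : ℕ} (h : 2 * j + 1 ≤ i) (z : Diagrams 0) :
    f j * (cup 0 i * z) = cup 0 i * (f j * z) := (isProjector_f j).comm_cup_assoc h z

theorem cap_f_comm {i j : ℕ} (h : 2 * j + 1 ≤ i) (z : Diagrams 0) :
    cap 0 i * (f j * z) = f j * (cap 0 i * z) := (isProjector_f j).comm_cap_assoc h z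

/-- The norm of the nested cups from `2j - 1` to `2j + 3` points is `-1` after multiplication
by this number. -/
def nestedScale (j : ℕ) : ℝ := √((j : ℝ) / (j + 1))

theorem nestedScale_zero : nestedScale 0 = 0 := by simp [nestedScale]

theorem nestedScale_mul_self (j : ℕ) :
    (nestedScale j : ℂ) * nestedScale j = j / (j + 1) := by
  rw [← Complex.ofReal_mul, nestedScale, Real.mul_self_sqrt (by positivity)]
  push_cast
  rfl

theorem nestedScale_ne_zero {j : ℕ} (h : j ≠ 0) : (nestedScale j : ℂ) ≠ 0 := by
  rw [Complex.ofReal_ne_zero, nestedScale, Real.sqrt_ne_zero']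
  positivity

/-- The normalized nested cups from `2j - 1` to `2j + 3` points. -/
def scaledCups (j : ℕ) : Diagrams 0 := (nestedScale j : ℂ) • nestedCups (j - 1)

/-- There is no downward step from one strand; the vanishing scale lets the fusion formulas hold for
every `j` without exception. -/
theorem scaledCups_zero : scaledCups 0 = 0 := by simp [scaledCups, nestedScale_zero]

theorem outerCup_mul (j : ℕ) (z : Diagrams 0) :
    outerCup j * z = f j * (cup 0 (2 * j + 1) * z) := by
  simp only [outerCup, mul_assoc]

theorem innerCup_mul (j : ℕ) (z : Diagrams 0) :
    innerCup j * z = f j * (cup 0 (2 * j) * (f j * z)) := by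
  simp only [innerCup, mul_assoc]

theorem nestedCups_mul (j : ℕ) (z : Diagrams 0) :
    nestedCups j * z = f (j + 1) * (cup 0 (2 * j + 2) * (cup 0 (2 * j + 1) * z)) := by
  simp (disch := omega) only [nestedCups, mul_assoc, ← f_cup_comm, f_mul_f_of_le]

theorem scaledCups_mul (j : ℕ) (z : Diagrams 0) :
    scaledCups j * z =
      (nestedScale j : ℂ) • (f j * (cup 0 (2 * j) * (cup 0 (2 * j - 1) * z))) := by
  cases j with
  | zero => simp [scaledCups, nestedScale_zero]
  | succ j =>
    rw [scaledCups, smul_mul_assoc, Nat.add_sub_cancel, nestedCups_mul]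
    rfl

theorem dagger_outerCup_mul (j : ℕ) (z : Diagrams 0) :
    dagger (outerCup j) * z = cap 0 (2 * j + 1) * (f j * z) := by
  simp only [outerCup, dagger_mul, dagger_cup, dagger_f, mul_assoc]

theorem dagger_innerCup_mul (j : ℕ) (z : Diagrams 0) :
    dagger (innerCup j) * z = f j * (cap 0 (2 * j) * (f j * z)) := by
  simp only [innerCup, dagger_mul, dagger_cup, dagger_f, mul_assoc]

theorem dagger_scaledCups_mul (j : ℕ) (z : Diagrams 0) :
    dagger (scaledCups j) * z =
      (nestedScale j : ℂ) • (cap 0 (2 * j - 1) * (cap 0 (2 * j) * (f j * z))) := by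
  have h : scaledCups j =
      (nestedScale j : ℂ) • (f j * (cup 0 (2 * j) * cup 0 (2 * j - 1))) := by
    simpa using scaledCups_mul j 1
  simp only [h, dagger_smul, dagger_mul, dagger_cup, dagger_f, mul_assoc, smul_mul_assoc]

theorem f_mul_outerCup (j : ℕ) : f j * outerCup j = outerCup j := by
  simp [outerCup]

theorem f_mul_innerCup (j : ℕ) : f j * innerCup j = innerCup j := by
  simp [innerCup, mul_assoc]

theorem f_mul_scaledCups (j : ℕ) : f j * scaledCups j = scaledCups j := by
  apply eq_of_forall_mul
  intro z
  simp only [mul_assoc, scaledCups_mul, mul_smul_comm, f_mul_f_assoc]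

theorem outerCup_mul_f (j : ℕ) : outerCup j * f j = outerCup j := by
  apply eq_of_forall_mul
  intro z
  simp only [mul_assoc]
  simp (disch := omega) only [outerCup_mul, ← f_cup_comm, f_mul_f_assoc]

theorem innerCup_mul_f (j : ℕ) : innerCup j * f j = innerCup j := by
  simp [innerCup, mul_assoc]

theorem scaledCups_mul_f (j : ℕ) : scaledCups j * f (j - 1) = scaledCups j := by
  simp [scaledCups, nestedCups, mul_assoc]

/-- The decomposition of `f_k ⊗ 1_2` into simple projections. -/
theorem f_eq_sum (j : ℕ) :
    f j = f (j + 1) + outerCup j * dagger (innerCup j) + innerCup j * dagger (outerCup j)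
      - scaledCups j * dagger (scaledCups j) := by
  apply eq_of_forall_mul
  intro z
  -- The decomposition is the recursion `jwStep` read backwards, with the nested term split as the
  -- square of `nestedScale`.
  rw [f_succ]
  simp only [add_mul, sub_mul, mul_assoc]
  simp (disch := omega) only [jwStep_mul_assoc, outerCup_mul,
    innerCup_mul, dagger_outerCup_mul, dagger_innerCup_mul, scaledCups_mul, dagger_scaledCups_mul,
    mul_smul_comm, smul_smul, nestedScale_mul_self, ← cap_f_comm, ← f_cup_comm, f_mul_f_assoc]
  module

/-- The middle idempotent between cup and cap is redundant: after expanding it by the recursion, the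
only other surviving term contains a cap that can be moved onto `f (j + 1)`. -/
theorem innerCup_mul_dagger (j : ℕ) :
    innerCup j * dagger (innerCup j) = f j * e 0 (2 * j + 1) * f j := by
  apply eq_of_forall_mul
  intro z
  simp only [mul_assoc, innerCup_mul, dagger_innerCup_mul, e, f_mul_f_assoc]
  cases j with
  | zero => simp only [f_zero, one_mul]
  | succ j =>
    have h (y : Diagrams 0) :
        f (j + 1) * (cup 0 (2 * (j + 1)) * (cup 0 (2 * j + 1) * (cap 0 (2 * j) *
          (f j * (cap 0 (2 * (j + 1)) * (f (j + 1) * y)))))) = 0 := by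
      simp (disch := omega) only [← cap_f_comm, f_mul_f_of_ge]
      rw [show 2 * (j + 1) = 2 * j + 2 by ring, ← cap_cap_assoc (by omega),
        cap_f_zero (by omega), mul_zero, mul_zero, mul_zero, mul_zero]
    nth_rewrite 2 [f_succ]
    rw [mul_cup_mul_jwStep (isProjector_f (j + 1)) (by ring) (isProjector_f j), h, sub_zero]

/-! ### The Gram matrix of the fusion rules -/

section Gram

variable (j : ℕ)

theorem dagger_outerCup_mul_outerCup : dagger (outerCup j) * outerCup j = 0 := by
  apply eq_of_forall_mul
  intro z
  simp only [mul_assoc]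
  simp (disch := omega) only [dagger_outerCup_mul, outerCup_mul, f_mul_f_assoc,
    cap_f_comm, cap_cup_assoc, mul_zero, zero_mul]

theorem dagger_outerCup_mul_innerCup : dagger (outerCup j) * innerCup j = f j := by
  apply eq_of_forall_mul
  intro z
  simp only [mul_assoc]
  simp (disch := omega) only [dagger_outerCup_mul, innerCup_mul, f_mul_f_assoc,
    cap_f_comm, cap_succ_cup_assoc]

theorem dagger_innerCup_mul_outerCup : dagger (innerCup j) * outerCup j = f j := by
  simpa using congrArg dagger (dagger_outerCup_mul_innerCup j)

theorem dagger_innerCup_mul_innerCup : dagger (innerCup j) * innerCup j = 0 := by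
  apply eq_of_forall_mul
  intro z
  simp only [mul_assoc]
  simp (disch := omega) only [dagger_innerCup_mul, innerCup_mul, f_mul_f_assoc,
    (isTraceless_f j).cap_mul_mul_cup, mul_zero, zero_mul]

theorem f_succ_mul_outerCup : f (j + 1) * outerCup j = 0 := by
  apply eq_of_forall_mul
  intro z
  simp only [mul_assoc]
  simp (disch := omega) only [outerCup_mul, f_mul_f_of_le, f_cup_zero, zero_mul]

theorem f_succ_mul_innerCup : f (j + 1) * innerCup j = 0 := by
  apply eq_of_forall_mul
  intro z
  simp only [mul_assoc]
  simp (disch := omega) only [innerCup_mul, f_mul_f_of_le, f_cup_zero, zero_mul]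

theorem f_succ_mul_scaledCups : f (j + 1) * scaledCups j = 0 := by
  apply eq_of_forall_mul
  intro z
  simp only [mul_assoc]
  simp (disch := omega) only [scaledCups_mul, mul_smul_comm, f_mul_f_of_le, f_cup_zero,
    zero_mul, smul_zero]

theorem dagger_scaledCups_mul_outerCup : dagger (scaledCups j) * outerCup j = 0 := by
  cases j with
  | zero => simp [scaledCups_zero]
  | succ j =>
    apply eq_of_forall_mul
    intro z
    simp only [mul_assoc]
    simp (disch := omega) only [dagger_scaledCups_mul, outerCup_mul, f_mul_f_assoc,
      f_cup_comm, cap_cup_succ_assoc, cap_f_zero, zero_mul, smul_zero]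

theorem cap_f_cup (j : ℕ) (z : Diagrams 0) :
    cap 0 (2 * (j + 1)) * (f (j + 1) * (cup 0 (2 * (j + 1)) * z)) =
      (-((j + 2) / (j + 1)) : ℂ) • (f j * (cup 0 (2 * j) * (cap 0 (2 * j) * (f j * z)))) := by
  rw [f_succ]
  exact trace_jwStep j (isProjector_f j) z

theorem dagger_scaledCups_mul_innerCup : dagger (scaledCups j) * innerCup j = 0 := by
  cases j with
  | zero => simp [scaledCups_zero]
  | succ j =>
    apply eq_of_forall_mul
    intro z
    simp only [mul_assoc]
    simp (disch := omega) only [dagger_scaledCups_mul, innerCup_mul, f_mul_f_assoc,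
      (isTraceless_f (j + 1)).cap_mul_mul_cup, mul_zero, zero_mul, smul_zero]

theorem nestedScale_mul_self_mul :
    (nestedScale (j + 1) : ℂ) * nestedScale (j + 1) * (-((j + 2) / (j + 1)) : ℂ) = -1 := by
  rw [nestedScale_mul_self]
  have : (j + 1 : ℂ) ≠ 0 := by exact_mod_cast j.succ_ne_zero
  have : (j + 2 : ℂ) ≠ 0 := by exact_mod_cast (j + 1).succ_ne_zero
  have : (j + 1 + 1 : ℂ) ≠ 0 := by exact_mod_cast (j + 1).succ_ne_zero
  push_cast
  field_simp
  ring

/-- The inner cups form a partial trace with factor `-(j+2)/(j+1)`, the outer ones straighten, and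
the scale removes the absolute value. The remaining sign is why the downward step carries a factor
`i`. -/
theorem dagger_scaledCups_mul_scaledCups :
    dagger (scaledCups (j + 1)) * scaledCups (j + 1) = (-1 : ℂ) • f j := by
  rw [← scaledCups_mul_f (j + 1), Nat.add_sub_cancel, dagger_mul, dagger_f]
  apply eq_of_forall_mul
  intro z
  simp only [mul_assoc]
  simp (disch := omega) only [dagger_scaledCups_mul, scaledCups_mul, f_mul_f_assoc,
    mul_smul_comm, cap_f_cup,
    show 2 * (j + 1) - 1 = 2 * j + 1 by omega, cap_f_comm, f_cup_comm, cap_succ_cup_assoc,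
    cap_cup_succ_assoc, smul_mul_assoc]
  match_scalars
  linear_combination nestedScale_mul_self_mul j

end Gram

/-- One step of a fusion path. -/
inductive IsStep : ℕ → ℕ → Diagrams 0 → Prop
  | up (j) : IsStep j (j + 1) (f (j + 1))
  | plus (j) : IsStep j j ((1 / (√2 : ℝ) : ℂ) • (outerCup j + innerCup j))
  | minus (j) : IsStep j j ((Complex.I / (√2 : ℝ) : ℂ) • (outerCup j - innerCup j))
  | down (j) : IsStep (j + 1) j (Complex.I • scaledCups (j + 1))

theorem nestedCups_eq (j : ℕ) :
    (Complex.I * (√((j + 1 : ℝ) / (j + 2)) : ℝ) : ℂ) • nestedCups j =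
      Complex.I • scaledCups (j + 1) := by
  rw [scaledCups, smul_smul, Nat.add_sub_cancel, nestedScale]
  congr 5 <;> push_cast <;> ring

theorem exists_step {m k : ℕ} (p : FusionPath (m + 1) k) :
    ∃ (j : ℕ) (q : FusionPath m j) (s : Diagrams 0), IsStep j k s ∧
      halfDiagram p = halfDiagram q * s := by
  cases p with
  | up p => exact ⟨_, p, _, .up _, rfl⟩
  | plus p => exact ⟨_, p, _, .plus _, rfl⟩
  | minus p => exact ⟨_, p, _, .minus _, rfl⟩
  | down p => exact ⟨_, p, _, .down _, by rw [halfDiagram, nestedCups_eq]⟩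

theorem IsStep.f_mul {j k : ℕ} {s : Diagrams 0} (h : IsStep j k s) : f j * s = s := by
  cases h with
  | up => simpa using f_mul_f_of_ge (Nat.le_succ j) 1
  | plus => rw [mul_smul_comm, mul_add, f_mul_outerCup, f_mul_innerCup]
  | minus => rw [mul_smul_comm, mul_sub, f_mul_outerCup, f_mul_innerCup]
  | down => rw [mul_smul_comm, f_mul_scaledCups]

theorem IsStep.mul_f {j k : ℕ} {s : Diagrams 0} (h : IsStep j k s) : s * f k = s := by
  cases h with
  | up => exact f_mul_f _
  | plus => rw [smul_mul_assoc, add_mul, outerCup_mul_f, innerCup_mul_f]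
  | minus => rw [smul_mul_assoc, sub_mul, outerCup_mul_f, innerCup_mul_f]
  | down => rw [smul_mul_assoc]; exact congrArg _ (scaledCups_mul_f (_ + 1))

theorem dagger_mul_eq_zero {x y : Diagrams 0} (h : dagger x * y = 0) : dagger y * x = 0 := by
  simpa using congrArg dagger h

theorem inv_sqrt_two_mul : (1 / (√2 : ℝ) : ℂ) * (1 / (√2 : ℝ) : ℂ) = 1 / 2 := by
  rw [div_mul_div_comm, ← Complex.ofReal_mul, Real.mul_self_sqrt (by norm_num)]
  norm_num

theorem I_div_sqrt_two_mul :
    (Complex.I / (√2 : ℝ) : ℂ) * (Complex.I / (√2 : ℝ) : ℂ) = -(1 / 2) := by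
  rw [div_mul_div_comm, ← Complex.ofReal_mul, Real.mul_self_sqrt (by norm_num), Complex.I_mul_I]
  norm_num

/-- Inner products of steps are real. -/
theorem IsStep.gram {j k k' : ℕ} {s t : Diagrams 0} (hs : IsStep j k s) (ht : IsStep j k' t) :
    ∃ c : ℝ, dagger s * t = (c : ℂ) • if k = k' then f k else 0 := by
  have h₁ := dagger_mul_eq_zero (dagger_scaledCups_mul_outerCup j)
  have h₂ := dagger_mul_eq_zero (dagger_scaledCups_mul_innerCup j)
  have h₃ : dagger (outerCup j) * f (j + 1) = 0 :=
    dagger_mul_eq_zero (by rw [dagger_f, f_succ_mul_outerCup])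
  have h₄ : dagger (innerCup j) * f (j + 1) = 0 :=
    dagger_mul_eq_zero (by rw [dagger_f, f_succ_mul_innerCup])
  have h₅ : dagger (scaledCups j) * f (j + 1) = 0 :=
    dagger_mul_eq_zero (by rw [dagger_f, f_succ_mul_scaledCups])
  cases hs <;> cases ht
  case up.up => exact ⟨1, by simp⟩
  case plus.plus =>
    refine ⟨1, ?_⟩
    rw [dagger_smul, smul_mul_smul_comm, inv_sqrt_two_mul]
    simp only [dagger_add, mul_add, add_mul, dagger_outerCup_mul_outerCup,
      dagger_outerCup_mul_innerCup, dagger_innerCup_mul_outerCup, dagger_innerCup_mul_innerCup,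
      if_true, Complex.ofReal_one]
    module
  case minus.minus =>
    refine ⟨1, ?_⟩
    rw [dagger_smul, smul_mul_smul_comm, I_div_sqrt_two_mul]
    simp only [dagger_sub, mul_sub, sub_mul, dagger_outerCup_mul_outerCup,
      dagger_outerCup_mul_innerCup, dagger_innerCup_mul_outerCup, dagger_innerCup_mul_innerCup,
      if_true, Complex.ofReal_one]
    module
  case down.down =>
    refine ⟨1, ?_⟩
    rw [dagger_smul, smul_mul_smul_comm, dagger_scaledCups_mul_scaledCups, smul_smul]
    simp
  all_goals
    refine ⟨0, ?_⟩
    simp [mul_add, add_mul, mul_sub, sub_mul, dagger_outerCup_mul_outerCup,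
      dagger_outerCup_mul_innerCup, dagger_innerCup_mul_outerCup, dagger_innerCup_mul_innerCup,
      f_succ_mul_outerCup, f_succ_mul_innerCup, f_succ_mul_scaledCups,
      dagger_scaledCups_mul_outerCup, dagger_scaledCups_mul_innerCup, h₁, h₂, h₃, h₄, h₅]

end Steps

/-! ### Half diagrams of paths and the resolution of the identity -/

section Paths

theorem halfDiagram_mul_f {m j : ℕ} (p : FusionPath m j) : halfDiagram p * f j = halfDiagram p := by
  cases m with
  | zero => cases p; rw [f_zero, mul_one]
  | succ m =>
    obtain ⟨i, q, s, hs, h⟩ := exists_step p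
    rw [h, mul_assoc, hs.mul_f]

theorem gram_halfDiagram (m : ℕ) {j k : ℕ} (p : FusionPath m j) (q : FusionPath m k) :
    ∃ c : ℝ, dagger (halfDiagram p) * halfDiagram q = (c : ℂ) • if j = k then f j else 0 := by
  induction m generalizing j k with
  | zero => cases p; cases q; exact ⟨1, by simp [halfDiagram, f_zero]⟩
  | succ m ih =>
    obtain ⟨i, p', s, hs, hp⟩ := exists_step p
    obtain ⟨i', q', t, ht, hq⟩ := exists_step q
    obtain ⟨c, hc⟩ := ih p' q'
    have h : dagger (halfDiagram p) * halfDiagram q =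
        (c : ℂ) • (dagger s * (if i = i' then f i else 0) * t) := by
      rw [hp, hq, dagger_mul, mul_assoc, ← mul_assoc _ _ t, hc]
      simp only [smul_mul_assoc, mul_smul_comm, mul_assoc]
    rw [h]
    by_cases hi : i = i'
    · subst hi
      obtain ⟨d, hd⟩ := hs.gram ht
      exact ⟨c * d, by rw [if_pos rfl, mul_assoc, ht.f_mul, hd, smul_smul, Complex.ofReal_mul]⟩
    · exact ⟨0, by simp [hi]⟩

/-- Planar isotopy: a cup to the right of all points of `v_p` moves down past it, and its position
changes by the difference between the numbers of top and bottom points. -/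
theorem cup_mul_halfDiagram (t : ℕ) {m j : ℕ} (p : FusionPath m j) :
    cup 0 (2 * m + 1 + t) * halfDiagram p = halfDiagram p * cup 0 (2 * j + 1 + t) := by
  induction m generalizing j t with
  | zero => cases p; simp [halfDiagram]
  | succ m ih =>
    obtain ⟨i, q, s, hs, h⟩ := exists_step p
    rw [h, ← mul_assoc, show 2 * (m + 1) + 1 + t = 2 * m + 1 + (t + 2) by ring, ih, mul_assoc,
      mul_assoc]
    congr 1
    have ha : cup 0 (2 * i + 1 + (t + 2)) * outerCup i = outerCup i * cup 0 (2 * i + 1 + t) := by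
      apply eq_of_forall_mul
      intro z
      simp only [mul_assoc]
      simp (disch := omega) only [outerCup_mul, ← f_cup_comm]
      rw [cup_cup_assoc (i := 2 * i + 1) (k := 2 * i + 1 + t) (by omega)]
      rfl
    have hb : cup 0 (2 * i + 1 + (t + 2)) * innerCup i = innerCup i * cup 0 (2 * i + 1 + t) := by
      apply eq_of_forall_mul
      intro z
      simp only [mul_assoc, innerCup_mul]
      rw [← f_cup_comm (by omega), f_cup_comm (i := 2 * i + 1 + t) (by omega),
        cup_cup_assoc (i := 2 * i) (by omega)]
      rfl
    cases hs with
    | up =>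
      apply eq_of_forall_mul
      intro z
      rw [mul_assoc, mul_assoc, f_cup_comm (by omega)]
      congr 2
      ring
    | plus => rw [mul_smul_comm, smul_mul_assoc, mul_add, add_mul, ha, hb]
    | minus => rw [mul_smul_comm, smul_mul_assoc, mul_sub, sub_mul, ha, hb]
    | down =>
      have hc (k : ℕ) : cup 0 (2 * (k + 1) + 1 + (t + 2)) * scaledCups (k + 1) =
          scaledCups (k + 1) * cup 0 (2 * k + 1 + t) := by
        apply eq_of_forall_mul
        intro z
        simp only [mul_assoc]
        simp only [scaledCups_mul, mul_smul_comm]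
        rw [← f_cup_comm (by omega), show 2 * (k + 1) - 1 = 2 * k + 1 by omega,
          cup_cup_assoc (i := 2 * k + 1) (k := 2 * k + 1 + t) (by omega),
          cup_cup_assoc (i := 2 * (k + 1)) (k := 2 * k + 1 + t + 2) (by omega)]
        congr 4
        ring
      rw [mul_smul_comm, smul_mul_assoc, hc]

theorem cap_mul_halfDiagram (t : ℕ) {m j : ℕ} (p : FusionPath m j) :
    cap 0 (2 * m + 1 + t) * halfDiagram p = halfDiagram p * cap 0 (2 * j + 1 + t) := by
  induction m generalizing j t with
  | zero => cases p; simp [halfDiagram]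
  | succ m ih =>
    obtain ⟨i, q, s, hs, h⟩ := exists_step p
    rw [h, ← mul_assoc, show 2 * (m + 1) + 1 + t = 2 * m + 1 + (t + 2) by ring, ih, mul_assoc,
      mul_assoc]
    congr 1
    have ha : cap 0 (2 * i + 1 + (t + 2)) * outerCup i = outerCup i * cap 0 (2 * i + 1 + t) := by
      apply eq_of_forall_mul
      intro z
      simp only [mul_assoc]
      simp (disch := omega) only [outerCup_mul, cap_f_comm]
      rw [cap_far_cup_assoc (by omega)]
      rfl
    have hb : cap 0 (2 * i + 1 + (t + 2)) * innerCup i = innerCup i * cap 0 (2 * i + 1 + t) := by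
      apply eq_of_forall_mul
      intro z
      simp only [mul_assoc]
      simp only [innerCup_mul]
      rw [cap_f_comm (by omega), cap_far_cup_assoc (by omega), cap_f_comm (by omega)]
      rfl
    cases hs with
    | up =>
      apply eq_of_forall_mul
      intro z
      rw [mul_assoc, mul_assoc, cap_f_comm (by omega)]
      congr 3
      ring
    | plus => rw [mul_smul_comm, smul_mul_assoc, mul_add, add_mul, ha, hb]
    | minus => rw [mul_smul_comm, smul_mul_assoc, mul_sub, sub_mul, ha, hb]
    | down =>
      have hc (k : ℕ) : cap 0 (2 * (k + 1) + 1 + (t + 2)) * scaledCups (k + 1) =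
          scaledCups (k + 1) * cap 0 (2 * k + 1 + t) := by
        apply eq_of_forall_mul
        intro z
        simp only [mul_assoc]
        simp only [scaledCups_mul, mul_smul_comm]
        rw [cap_f_comm (by omega), cap_far_cup_assoc (by omega), cap_far_cup_assoc (by omega),
          show 2 * (k + 1) + 1 + (t + 2) - 2 - 2 = 2 * k + 1 + t by omega]
      rw [mul_smul_comm, smul_mul_assoc, hc]

theorem e_mul_halfDiagram (t : ℕ) {m j : ℕ} (p : FusionPath m j) :
    e 0 (2 * m + 2 + t) * halfDiagram p = halfDiagram p * e 0 (2 * j + 2 + t) := by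
  rw [show 2 * m + 2 + t = (2 * m + 1 + t) + 1 by ring,
    show 2 * j + 2 + t = (2 * j + 1 + t) + 1 by ring, e, e, mul_assoc, cap_mul_halfDiagram,
    ← mul_assoc, cup_mul_halfDiagram, mul_assoc]

theorem FusionPath.isEmpty_of_lt (m : ℕ) {j : ℕ} (h : m < j) : IsEmpty (FusionPath m j) := by
  induction m generalizing j with
  | zero =>
    refine ⟨fun p => ?_⟩
    cases p
    omega
  | succ m ih =>
    refine ⟨fun p => ?_⟩
    cases p with
    | up p => exact (ih (by omega)).false p
    | plus p => exact (ih (by omega)).false p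
    | minus p => exact (ih (by omega)).false p
    | down p => exact (ih (by omega)).false p

/-- The last step of a path that ends at one strand. -/
def FusionPath.equivZero (m : ℕ) :
    FusionPath m 0 ⊕ FusionPath m 0 ⊕ FusionPath m 1 ≃ FusionPath (m + 1) 0 where
  toFun := Sum.elim .plus (Sum.elim .minus .down)
  invFun
    | .plus p => .inl p
    | .minus p => .inr (.inl p)
    | .down p => .inr (.inr p)
  left_inv := by rintro (p | p | p) <;> rfl
  right_inv p := by cases p <;> rfl

/-- The last step of a path that ends at more than one strand. -/
def FusionPath.equivSucc (m j : ℕ) :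
    FusionPath m j ⊕ FusionPath m (j + 1) ⊕ FusionPath m (j + 1) ⊕ FusionPath m (j + 2) ≃
      FusionPath (m + 1) (j + 1) where
  toFun := Sum.elim .up (Sum.elim .plus (Sum.elim .minus .down))
  invFun
    | .up p => .inl p
    | .plus p => .inr (.inl p)
    | .minus p => .inr (.inr (.inl p))
    | .down p => .inr (.inr (.inr p))
  left_inv := by rintro (p | p | p | p) <;> rfl
  right_inv p := by cases p <;> rfl

theorem FusionPath.sum_zero (m : ℕ) (g : ∀ j, FusionPath (m + 1) j → Diagrams 0) :
    ∑ p, g 0 p = ∑ p : FusionPath m 0, (g 0 p.plus + g 0 p.minus) +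
      ∑ p : FusionPath m 1, g 0 p.down := by
  rw [← (FusionPath.equivZero m).sum_comp, Fintype.sum_sum_type, Fintype.sum_sum_type,
    Finset.sum_add_distrib, add_assoc]
  rfl

theorem FusionPath.sum_succ (m j : ℕ) (g : ∀ j, FusionPath (m + 1) j → Diagrams 0) :
    ∑ p, g (j + 1) p = ∑ p : FusionPath m j, g (j + 1) p.up +
      (∑ p : FusionPath m (j + 1), (g (j + 1) p.plus + g (j + 1) p.minus) +
      ∑ p : FusionPath m (j + 2), g (j + 1) p.down) := by
  rw [← (FusionPath.equivSucc m j).sum_comp, Fintype.sum_sum_type, Fintype.sum_sum_type,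
    Fintype.sum_sum_type, Finset.sum_add_distrib, add_assoc]
  rfl

theorem FusionPath.sum_of_lt {m j : ℕ} (h : m < j) (g : FusionPath m j → Diagrams 0) :
    ∑ p, g p = 0 := by
  have := FusionPath.isEmpty_of_lt m h
  exact Fintype.sum_empty g

theorem matrixUnit_down {m j : ℕ} (p : FusionPath m (j + 1)) :
    matrixUnit p.down p.down = -(halfDiagram p * (scaledCups (j + 1) *
      dagger (scaledCups (j + 1))) * dagger (halfDiagram p)) := by
  rw [matrixUnit, halfDiagram, nestedCups_eq]
  simp only [dagger_mul, dagger_smul, mul_smul_comm, smul_mul_assoc, smul_smul, Complex.I_mul_I,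
    mul_assoc]
  module

/-- Polarization: half of `(a + b)(a + b)†` minus half of `(a - b)(a - b)†`, the sign coming from
`i² = -1`. -/
theorem matrixUnit_plus_add_minus {m j : ℕ} (p : FusionPath m j) :
    matrixUnit p.plus p.plus + matrixUnit p.minus p.minus = halfDiagram p *
      (outerCup j * dagger (innerCup j) + innerCup j * dagger (outerCup j)) *
        dagger (halfDiagram p) := by
  have h : ((1 / (√2 : ℝ) : ℂ) • (outerCup j + innerCup j)) *
        dagger ((1 / (√2 : ℝ) : ℂ) • (outerCup j + innerCup j)) +
      ((Complex.I / (√2 : ℝ) : ℂ) • (outerCup j - innerCup j)) *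
        dagger ((Complex.I / (√2 : ℝ) : ℂ) • (outerCup j - innerCup j)) =
      outerCup j * dagger (innerCup j) + innerCup j * dagger (outerCup j) := by
    rw [dagger_smul, dagger_smul, smul_mul_smul_comm, smul_mul_smul_comm, inv_sqrt_two_mul,
      I_div_sqrt_two_mul]
    simp only [dagger_add, dagger_sub, mul_add, add_mul, mul_sub, sub_mul]
    module
  rw [← h, matrixUnit, matrixUnit, halfDiagram, halfDiagram, dagger_mul (halfDiagram p),
    dagger_mul (halfDiagram p)]
  simp only [mul_add, add_mul, mul_assoc]

/-- The matrix units sum to the identity. -/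
theorem sum_matrixUnit (m : ℕ) :
    ∑ j ∈ Finset.range (m + 1), ∑ p : FusionPath m j, matrixUnit p p = 1 := by
  induction m with
  | zero =>
    have : ∀ p : FusionPath 0 0, matrixUnit p p = 1 := fun p => by
      cases p; simp [matrixUnit, halfDiagram]
    have h₁ : Fintype.card (FusionPath 0 0) = 1 :=
      Fintype.card_eq_one_iff.2 ⟨.start, fun p => by cases p; rfl⟩
    simp [this, h₁]
  | succ m ih =>
    rw [Finset.sum_range_succ', FusionPath.sum_zero m fun j p => matrixUnit p p]
    simp only [FusionPath.sum_succ m _ fun j p => matrixUnit p p, Finset.sum_add_distrib (ι := ℕ)]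
    -- Sums over last steps are regrouped by the vertex from which the step starts. The surplus
    -- vertices carry no path of length `m`, and the missing downward term at `j = 0` is zero.
    have h₁ : ∑ j ∈ Finset.range (m + 1), ∑ p : FusionPath m (j + 1),
          (matrixUnit p.plus p.plus + matrixUnit p.minus p.minus) +
        ∑ p : FusionPath m 0, (matrixUnit p.plus p.plus + matrixUnit p.minus p.minus) =
        ∑ j ∈ Finset.range (m + 1), ∑ p : FusionPath m j,
          (matrixUnit p.plus p.plus + matrixUnit p.minus p.minus) := by
      rw [← Finset.sum_range_succ' (fun j => ∑ p : FusionPath m j,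
        (matrixUnit p.plus p.plus + matrixUnit p.minus p.minus)), Finset.sum_range_succ,
        FusionPath.sum_of_lt (Nat.lt_succ_self m), add_zero]
    have h₂ : ∑ j ∈ Finset.range (m + 1), ∑ p : FusionPath m (j + 2),
          matrixUnit p.down p.down + ∑ p : FusionPath m 1, matrixUnit p.down p.down =
        -∑ j ∈ Finset.range (m + 1), ∑ p : FusionPath m j, halfDiagram p * (scaledCups j *
          dagger (scaledCups j)) * dagger (halfDiagram p) := by
      rw [← Finset.sum_range_succ' (fun j => ∑ p : FusionPath m (j + 1),
        matrixUnit p.down p.down), Finset.sum_range_succ, Finset.sum_range_succ,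
        FusionPath.sum_of_lt (by omega), FusionPath.sum_of_lt (by omega), add_zero, add_zero,
        Finset.sum_range_succ']
      simp only [matrixUnit_down, scaledCups_zero, zero_mul, mul_zero, Finset.sum_const_zero,
        add_zero, Finset.sum_neg_distrib]
    rw [add_assoc, add_add_add_comm, h₁, h₂, ← ih, ← Finset.sum_neg_distrib,
      ← Finset.sum_add_distrib, ← Finset.sum_add_distrib]
    refine Finset.sum_congr rfl fun j _ => ?_
    rw [← Finset.sum_neg_distrib, ← Finset.sum_add_distrib, ← Finset.sum_add_distrib]
    refine Finset.sum_congr rfl fun p _ => ?_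
    have h₃ : matrixUnit p.up p.up = halfDiagram p * f (j + 1) * dagger (halfDiagram p) := by
      rw [matrixUnit, halfDiagram, dagger_mul, dagger_f, mul_assoc, f_mul_f_assoc, mul_assoc]
    have h₄ : matrixUnit p p = halfDiagram p * f j * dagger (halfDiagram p) := by
      rw [halfDiagram_mul_f, matrixUnit]
    rw [matrixUnit_plus_add_minus, h₃, h₄, f_eq_sum j]
    simp only [mul_add, add_mul, mul_sub, sub_mul]
    abel

end Paths

section Neg

theorem neg_one_smul_diagram (x : Diagrams 0) : (-1 : ℂ) • x = -x := neg_one_smul ℂ x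

theorem neg_mul_diagram (x y : Diagrams 0) : -x * y = -(x * y) := neg_mul x y

theorem mul_neg_diagram (x y : Diagrams 0) : x * -y = -(x * y) := mul_neg x y

theorem neg_neg_diagram (x : Diagrams 0) : - -x = x := neg_neg x

end Neg

/-! ### Conjugation of half diagrams and of matrix units -/

section HalfAdjoint

/-- `x` and `x'` are linear combinations of the half diagrams `v_p` with complex conjugate
coefficients. -/
inductive HalfConj (m j : ℕ) : Diagrams 0 → Diagrams 0 → Prop
  | path (p : FusionPath m j) : HalfConj m j (halfDiagram p) (halfDiagram p)
  | zero : HalfConj m j 0 0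
  | add {x x' y y'} : HalfConj m j x x' → HalfConj m j y y' → HalfConj m j (x + y) (x' + y')
  | smul (c : ℂ) {x x'} : HalfConj m j x x' → HalfConj m j (c • x) (conj c • x')

/-- `x` and `x'` are linear combinations of the matrix units `v_{p,q}` and `v_{q,p}` with complex
conjugate coefficients. -/
inductive LevelAdjoint (m : ℕ) : Diagrams 0 → Diagrams 0 → Prop
  | unit {j} (p q : FusionPath m j) : LevelAdjoint m (matrixUnit p q) (matrixUnit q p)
  | zero : LevelAdjoint m 0 0
  | add {x x' y y'} : LevelAdjoint m x x' → LevelAdjoint m y y' → LevelAdjoint m (x + y) (x' + y')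
  | smul (c : ℂ) {x x'} : LevelAdjoint m x x' → LevelAdjoint m (c • x) (conj c • x')

namespace HalfConj

variable {m j : ℕ} {x x' y y' : Diagrams 0}

theorem smul_real (c : ℝ) (h : HalfConj m j x x') : HalfConj m j ((c : ℂ) • x) ((c : ℂ) • x') := by
  simpa using h.smul (c : ℂ)

theorem neg (h : HalfConj m j x x') : HalfConj m j (-x) (-x') := by
  have := h.smul_real (-1)
  rwa [Complex.ofReal_neg, Complex.ofReal_one, neg_one_smul_diagram,
    neg_one_smul_diagram] at this

theorem sub (h : HalfConj m j x x') (h' : HalfConj m j y y') :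
    HalfConj m j (x - y) (x' - y') := by
  rw [sub_eq_add_neg, sub_eq_add_neg]
  exact h.add h'.neg

theorem mul_f (h : HalfConj m j x x') : x * f j = x ∧ x' * f j = x' := by
  induction h with
  | path p => exact ⟨halfDiagram_mul_f p, halfDiagram_mul_f p⟩
  | zero => exact ⟨zero_mul _, zero_mul _⟩
  | add _ _ h h' => exact ⟨by rw [add_mul, h.1, h'.1], by rw [add_mul, h.2, h'.2]⟩
  | smul c _ h => exact ⟨by rw [smul_mul_assoc, h.1], by rw [smul_mul_assoc, h.2]⟩

/-- Right multiplication preserves conjugate half diagrams if it does so on paths. -/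
theorem mul_of_path {m' j' : ℕ} {s t : Diagrams 0}
    (hst : ∀ p : FusionPath m j, HalfConj m' j' (halfDiagram p * s) (halfDiagram p * t))
    (h : HalfConj m j x x') : HalfConj m' j' (x * s) (x' * t) := by
  induction h with
  | path p => exact hst p
  | zero => rw [zero_mul, zero_mul]; exact .zero
  | add _ _ h h' => rw [add_mul, add_mul]; exact h.add h'
  | smul c _ h => rw [smul_mul_assoc, smul_mul_assoc]; exact h.smul c

theorem mul_f_succ (h : HalfConj m j x x') :
    HalfConj (m + 1) (j + 1) (x * f (j + 1)) (x' * f (j + 1)) :=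
  h.mul_of_path fun p => .path p.up

theorem conj_inv_sqrt_two : conj (1 / (√2 : ℝ) : ℂ) = 1 / (√2 : ℝ) := by
  rw [map_div₀, map_one, Complex.conj_ofReal]

theorem conj_neg_I_div_sqrt_two : conj (-(Complex.I / (√2 : ℝ)) : ℂ) = Complex.I / (√2 : ℝ) := by
  rw [map_neg, map_div₀, Complex.conj_I, Complex.conj_ofReal]
  ring

theorem conj_I_div_sqrt_two : conj (Complex.I / (√2 : ℝ) : ℂ) = -(Complex.I / (√2 : ℝ)) := by
  rw [map_div₀, Complex.conj_I, Complex.conj_ofReal]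
  ring

theorem smul_plus_sub_smul_minus (p : FusionPath m j) :
    (1 / (√2 : ℝ) : ℂ) • halfDiagram p.plus + (-(Complex.I / (√2 : ℝ)) : ℂ) • halfDiagram p.minus
      = halfDiagram p * outerCup j := by
  rw [halfDiagram, halfDiagram, mul_smul_comm, mul_smul_comm, smul_smul, smul_smul, neg_mul,
    inv_sqrt_two_mul, I_div_sqrt_two_mul, mul_add, mul_sub]
  module

theorem smul_plus_add_smul_minus (p : FusionPath m j) :
    (1 / (√2 : ℝ) : ℂ) • halfDiagram p.plus + (Complex.I / (√2 : ℝ) : ℂ) • halfDiagram p.minus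
      = halfDiagram p * innerCup j := by
  rw [halfDiagram, halfDiagram, mul_smul_comm, mul_smul_comm, smul_smul, smul_smul,
    inv_sqrt_two_mul, I_div_sqrt_two_mul, mul_add, mul_sub]
  module

/-- Inverting the fusion rules gives `a = (v₊ - i v₋)/√2` and `b = (v₊ + i v₋)/√2`: their
coordinates are conjugate, so conjugation interchanges them. -/
theorem mul_outerCup (h : HalfConj m j x x') :
    HalfConj (m + 1) j (x * outerCup j) (x' * innerCup j) :=
  h.mul_of_path fun p => by
    have := ((path p.plus).smul (1 / (√2 : ℝ) : ℂ)).add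
      ((path p.minus).smul (-(Complex.I / (√2 : ℝ)) : ℂ))
    rwa [conj_inv_sqrt_two, conj_neg_I_div_sqrt_two, smul_plus_sub_smul_minus,
      smul_plus_add_smul_minus] at this

theorem mul_innerCup (h : HalfConj m j x x') :
    HalfConj (m + 1) j (x * innerCup j) (x' * outerCup j) :=
  h.mul_of_path fun p => by
    have := ((path p.plus).smul (1 / (√2 : ℝ) : ℂ)).add
      ((path p.minus).smul (Complex.I / (√2 : ℝ) : ℂ))
    rwa [conj_inv_sqrt_two, conj_I_div_sqrt_two, smul_plus_sub_smul_minus,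
      smul_plus_add_smul_minus] at this

/-- The basis vector is `i c`, so `c` has coordinate `-i` and changes sign. -/
theorem mul_scaledCups_succ (h : HalfConj m (j + 1) x x') :
    HalfConj (m + 1) j (x * scaledCups (j + 1)) (-(x' * scaledCups (j + 1))) := by
  rw [← mul_neg_diagram]
  refine h.mul_of_path fun p => ?_
  have h₁ : halfDiagram p.down = Complex.I • (halfDiagram p * scaledCups (j + 1)) := by
    rw [halfDiagram, nestedCups_eq, mul_smul_comm]
  have h₂ := (path p.down).smul (-Complex.I)
  rw [h₁, smul_smul, smul_smul, map_neg, Complex.conj_I, neg_mul, neg_neg, Complex.I_mul_I,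
    neg_neg, one_smul, neg_one_smul_diagram] at h₂
  rwa [mul_neg_diagram]

theorem mul_scaledCups (h : HalfConj m j x x') :
    HalfConj (m + 1) (j - 1) (x * scaledCups j) (-(x' * scaledCups j)) := by
  cases j with
  | zero => simpa [scaledCups_zero] using zero
  | succ j => exact h.mul_scaledCups_succ

theorem mul_scaledCups_mul_f (h : HalfConj m j x x') :
    HalfConj (m + 2) j (x * scaledCups j * f j) (-(x' * scaledCups j * f j)) := by
  cases j with
  | zero => simpa [scaledCups_zero] using zero
  | succ j => simpa only [neg_mul_diagram] using h.mul_scaledCups_succ.mul_f_succ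

/-- As `dagger` is linear, coefficients of either factor enter the first product as they are and the
second one conjugated. -/
theorem mul_dagger (h : HalfConj m j x x') (h' : HalfConj m j y y') :
    LevelAdjoint m (x * dagger y) (y' * dagger x') := by
  induction h with
  | path p =>
    induction h' with
    | path q => exact .unit p q
    | zero => rw [dagger_zero, mul_zero, zero_mul]; exact .zero
    | add _ _ h h' => rw [dagger_add, mul_add, add_mul]; exact h.add h'
    | smul c _ h =>
      rw [dagger_smul, mul_smul_comm, smul_mul_assoc]
      exact h.smul c
  | zero => rw [dagger_zero, mul_zero, zero_mul]; exact .zero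
  | add _ _ h h' => rw [dagger_add, mul_add, add_mul]; exact h.add h'
  | smul c _ h => rw [dagger_smul, mul_smul_comm, smul_mul_assoc]; exact h.smul c

end HalfConj

/-! ### The graph of the involution on one level -/

namespace LevelAdjoint

variable {m : ℕ} {x x' y y' : Diagrams 0}

theorem neg (h : LevelAdjoint m x x') : LevelAdjoint m (-x) (-x') := by
  have := h.smul (-1)
  rwa [map_neg, map_one, neg_one_smul_diagram, neg_one_smul_diagram] at this

theorem sub (h : LevelAdjoint m x x') (h' : LevelAdjoint m y y') :
    LevelAdjoint m (x - y) (x' - y') := by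
  rw [sub_eq_add_neg, sub_eq_add_neg]
  exact h.add h'.neg

theorem sum {ι : Type*} (s : Finset ι) {g g' : ι → Diagrams 0}
    (h : ∀ i ∈ s, LevelAdjoint m (g i) (g' i)) :
    LevelAdjoint m (∑ i ∈ s, g i) (∑ i ∈ s, g' i) := by
  classical
  induction s using Finset.induction_on with
  | empty => exact .zero
  | insert i s hi ih =>
    rw [Finset.sum_insert hi, Finset.sum_insert hi]
    exact (h i (Finset.mem_insert_self i s)).add
      (ih fun k hk => h k (Finset.mem_insert_of_mem hk))

theorem symm (h : LevelAdjoint m x x') : LevelAdjoint m x' x := by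
  induction h with
  | unit p q => exact .unit q p
  | zero => exact .zero
  | add _ _ h h' => exact h.add h'
  | smul c _ h => simpa using h.smul (conj c)

/-- Insert `f_eq_sum` between `v_p` and `v_q†`. Conjugation reverses each product and interchanges
`a` and `b`, so each mixed term keeps its shape with `p` and `q` exchanged; the two signs of `c`
cancel. -/
theorem succ (h : LevelAdjoint m x x') : LevelAdjoint (m + 1) x x' := by
  induction h with
  | zero => exact .zero
  | add _ _ h h' => exact h.add h'
  | smul c _ h => exact h.smul c
  | @unit j p q =>
    have h (p q : FusionPath m j) : matrixUnit p q =
        halfDiagram p * f (j + 1) * dagger (halfDiagram q * f (j + 1)) +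
        halfDiagram p * outerCup j * dagger (halfDiagram q * innerCup j) +
        halfDiagram p * innerCup j * dagger (halfDiagram q * outerCup j) -
        halfDiagram p * scaledCups j * dagger (halfDiagram q * scaledCups j) := by
      have h₁ : matrixUnit p q = halfDiagram p * f j * dagger (halfDiagram q) := by
        rw [halfDiagram_mul_f, matrixUnit]
      rw [h₁, f_eq_sum]
      simp only [dagger_mul, dagger_f, mul_add, add_mul, mul_sub, sub_mul, mul_assoc,
        f_mul_f_assoc]
    have hp := HalfConj.path p
    have hq := HalfConj.path q
    have := (((hp.mul_f_succ.mul_dagger hq.mul_f_succ).add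
      (hp.mul_outerCup.mul_dagger hq.mul_innerCup)).add
      (hp.mul_innerCup.mul_dagger hq.mul_outerCup)).sub
      (hp.mul_scaledCups.mul_dagger hq.mul_scaledCups)
    simp only [dagger_neg, neg_mul_diagram, mul_neg_diagram, neg_neg_diagram] at this
    rw [← h p q] at this
    convert this using 1
    rw [h q p]

theorem mono {n : ℕ} (hmn : m ≤ n) (h : LevelAdjoint m x x') : LevelAdjoint n x x' := by
  induction n, hmn using Nat.le_induction with
  | base => exact h
  | succ n _ ih => exact ih.succ

theorem mul (h : LevelAdjoint m x x') (h' : LevelAdjoint m y y') :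
    LevelAdjoint m (x * y) (y' * x') := by
  induction h with
  | zero => rw [mul_zero, zero_mul]; exact .zero
  | add _ _ h h' => rw [mul_add, add_mul]; exact h.add h'
  | smul c _ h => rw [mul_smul_comm, smul_mul_assoc]; exact h.smul c
  | @unit j p q =>
    induction h' with
    | zero => rw [mul_zero, zero_mul]; exact .zero
    | add _ _ h h' => rw [mul_add, add_mul]; exact h.add h'
    | smul c _ h => rw [mul_smul_comm, smul_mul_assoc]; exact h.smul c
    | @unit k r s =>
      -- Reality of this inner product is essential: reflection leaves it unchanged, whereas the
      -- involution would conjugate it.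
      obtain ⟨c, hc⟩ := gram_halfDiagram m q r
      have h₁ : matrixUnit p q * matrixUnit r s =
          halfDiagram p * (dagger (halfDiagram q) * halfDiagram r) * dagger (halfDiagram s) := by
        simp only [matrixUnit, mul_assoc]
      have h₂ : matrixUnit s r * matrixUnit q p =
          halfDiagram s * dagger (dagger (halfDiagram q) * halfDiagram r) *
            dagger (halfDiagram p) := by
        simp only [matrixUnit, mul_assoc, dagger_mul, dagger_dagger]
      rw [h₁, h₂, hc]
      by_cases hjk : j = k
      · subst hjk
        rw [if_pos rfl, dagger_smul, dagger_f, mul_smul_comm, mul_smul_comm, halfDiagram_mul_f,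
          halfDiagram_mul_f]
        simpa [matrixUnit] using (LevelAdjoint.unit p s).smul (c : ℂ)
      · simpa [hjk] using LevelAdjoint.zero

theorem one : LevelAdjoint 0 1 1 := by
  simpa [matrixUnit, halfDiagram] using LevelAdjoint.unit .start .start

theorem exists_coeff (h : LevelAdjoint m x x') {j k : ℕ} (p : FusionPath m j)
    (q : FusionPath m k) : ∃ c : ℂ,
      dagger (halfDiagram p) * x * halfDiagram q = c • (if j = k then f j else 0) ∧
      dagger (halfDiagram q) * x' * halfDiagram p = conj c • (if j = k then f j else 0) := by
  induction h with
  | zero => exact ⟨0, by simp, by simp⟩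
  | add _ _ h h' =>
    obtain ⟨c, h₁, h₂⟩ := h
    obtain ⟨d, h₃, h₄⟩ := h'
    exact ⟨c + d, by rw [mul_add, add_mul, h₁, h₃, add_smul],
      by rw [mul_add, add_mul, h₂, h₄, map_add, add_smul]⟩
  | smul d _ h =>
    obtain ⟨c, h₁, h₂⟩ := h
    exact ⟨d * c, by rw [mul_smul_comm, smul_mul_assoc, h₁, smul_smul],
      by rw [mul_smul_comm, smul_mul_assoc, h₂, smul_smul, map_mul]⟩
  | @unit i r s =>
    obtain ⟨c, hc⟩ := gram_halfDiagram m p r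
    obtain ⟨d, hd⟩ := gram_halfDiagram m s q
    have hc' := congrArg dagger hc
    have hd' := congrArg dagger hd
    simp only [dagger_mul, dagger_dagger, dagger_smul] at hc' hd'
    have h₁ : dagger (halfDiagram p) * matrixUnit r s * halfDiagram q =
        ((c * d : ℂ)) • ((if j = i then f j else 0) * (if i = k then f i else 0)) := by
      rw [matrixUnit, ← mul_assoc, hc, mul_assoc, hd, smul_mul_smul_comm]
    have h₂ : dagger (halfDiagram q) * matrixUnit s r * halfDiagram p =
        ((d * c : ℂ)) • (dagger (if i = k then f i else 0) * dagger (if j = i then f j else 0)) := by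
      rw [matrixUnit, ← mul_assoc, hd', mul_assoc, hc', smul_mul_smul_comm]
    rw [h₁, h₂]
    by_cases hji : j = i
    · subst hji
      by_cases hjk : j = k
      · exact ⟨c * d, by simp [hjk], by simp [hjk, mul_comm]⟩
      · exact ⟨0, by simp [hjk], by simp [hjk]⟩
    · exact ⟨0, by simp [hji], by simp [hji]⟩

/-- All coefficients of `x` between paths are conjugates of coefficients of zero, since `f j ≠ 0`.
The resolution of the identity then recovers `x`. -/
theorem eq_zero (h : LevelAdjoint m 0 x) : x = 0 := by
  have h₁ {j k : ℕ} (p : FusionPath m j) (q : FusionPath m k) :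
      dagger (halfDiagram q) * x * halfDiagram p = 0 := by
    obtain ⟨c, hc, hc'⟩ := h.exists_coeff p q
    rw [hc']
    by_cases hjk : j = k
    · rw [mul_zero, zero_mul, if_pos hjk] at hc
      have := smul_left_injective ℂ (f_ne_zero j) (hc.symm.trans (zero_smul ℂ _).symm)
      simp [show c = 0 from this]
    · simp [hjk]
  rw [← one_mul x, ← mul_one (1 * x), ← sum_matrixUnit m]
  simp only [Finset.sum_mul, Finset.mul_sum, matrixUnit]
  refine Finset.sum_eq_zero fun k _ => Finset.sum_eq_zero fun q _ =>
    Finset.sum_eq_zero fun j _ => Finset.sum_eq_zero fun p _ => ?_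
  rw [← mul_assoc, mul_assoc (halfDiagram _), mul_assoc (halfDiagram _), h₁, mul_zero, zero_mul]

end LevelAdjoint

end HalfAdjoint

/-! ### Two-step expansions near the last strands -/

section LocalGenerators

/-- The element of `TL_∞` that is the conjugate of `e_{i+1}`, for `i ≥ 2` even. -/
def oddConj (i : ℕ) : Diagrams 0 :=
  e 0 i + e 0 (i + 2) + e 0 i * e 0 (i + 1) * e 0 (i + 2) + e 0 (i + 2) * e 0 (i + 1) * e 0 i
    - e 0 i * e 0 (i + 2) * e 0 (i + 1) - e 0 (i + 1) * e 0 i * e 0 (i + 2)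

variable (j : ℕ)

/-- Inserting `f_eq_sum` to the left of the cup gives the expansion along the first of two steps.
The lemmas below take for `y` the four possible second factors `f (j + 1)`, `a`, `b`, `c`. -/
theorem f_cup_mul {y : Diagrams 0} (hy : f j * y = y) :
    f j * (cup 0 (2 * j + 2) * y) = f (j + 1) * (cup 0 (2 * j + 2) * y) +
      outerCup j * (f j * (cup 0 (2 * j) * (cap 0 (2 * j) * y))) + innerCup j * y -
      (nestedScale j : ℂ) • (scaledCups j * (cap 0 (2 * j) * y)) := by
  conv_lhs => rw [f_eq_sum j]
  simp only [add_mul, sub_mul, mul_assoc]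
  have h₁ : dagger (innerCup j) * (cup 0 (2 * j + 2) * y) =
      f j * (cup 0 (2 * j) * (cap 0 (2 * j) * y)) := by
    rw [dagger_innerCup_mul, f_cup_comm (by omega), cap_cup_far_assoc (by omega),
      Nat.add_sub_cancel, hy]
  have h₂ : dagger (outerCup j) * (cup 0 (2 * j + 2) * y) = y := by
    rw [dagger_outerCup_mul, f_cup_comm (by omega), cap_cup_succ_assoc (by omega), hy]
  have h₃ : dagger (scaledCups j) * (cup 0 (2 * j + 2) * y) =
      (nestedScale j : ℂ) • (cap 0 (2 * j) * y) := by
    rw [dagger_scaledCups_mul, f_cup_comm (by omega), cap_cup_far_assoc (by omega),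
      Nat.add_sub_cancel, hy]
    cases j with
    | zero => simp [nestedScale_zero]
    | succ j => rw [cap_cup_succ_assoc (by omega)]
  rw [h₁, h₂, h₃, mul_smul_comm]

theorem f_cup_f_succ :
    f j * cup 0 (2 * j + 2) * f (j + 1) =
      f (j + 1) * innerCup (j + 1) + innerCup j * f (j + 1) := by
  apply eq_of_forall_mul
  intro z
  simp only [add_mul, mul_assoc]
  rw [f_cup_mul j (f_mul_f_of_ge (Nat.le_succ j) z), cap_f_zero (by omega),
    innerCup_mul (j + 1), f_mul_f_assoc]
  simp only [mul_zero, smul_zero, add_zero, sub_zero]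
  rfl

theorem f_cup_outerCup :
    f j * cup 0 (2 * j + 2) * outerCup j =
      f (j + 1) * nestedCups j + outerCup j * innerCup j + innerCup j * outerCup j -
        (nestedScale j : ℂ) • (scaledCups j * f j) := by
  apply eq_of_forall_mul
  intro z
  simp only [add_mul, sub_mul, mul_assoc, smul_mul_assoc]
  rw [f_cup_mul j (by rw [outerCup_mul, f_mul_f_assoc])]
  have h₁ : cap 0 (2 * j) * (outerCup j * z) = f j * z := by
    rw [outerCup_mul, f_cup_comm (by omega), cap_cup_succ_assoc (by omega)]
  have h₂ : f (j + 1) * (cup 0 (2 * j + 2) * (outerCup j * z)) = f (j + 1) * (nestedCups j * z) := by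
    rw [nestedCups_mul, f_mul_f_assoc, outerCup_mul, ← f_cup_comm (by omega),
      f_mul_f_of_le (Nat.le_succ j)]
  rw [h₁, h₂, ← innerCup_mul]

theorem f_cup_innerCup :
    f j * cup 0 (2 * j + 2) * innerCup j = innerCup j * innerCup j := by
  apply eq_of_forall_mul
  intro z
  simp only [mul_assoc]
  rw [f_cup_mul j (by rw [innerCup_mul, f_mul_f_assoc])]
  have h₁ : cap 0 (2 * j) * (innerCup j * z) = 0 := by
    rw [innerCup_mul, (isTraceless_f j).cap_mul_mul_cup]
  have h₂ : f (j + 1) * (cup 0 (2 * j + 2) * (innerCup j * z)) = 0 := by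
    rw [innerCup_mul, ← f_cup_comm (by omega), f_mul_f_of_le (Nat.le_succ j),
      ← cup_cup_assoc le_rfl, f_cup_zero (by omega)]
  rw [h₁, h₂]
  simp

theorem f_cup_scaledCups :
    f j * cup 0 (2 * j + 2) * scaledCups j =
      innerCup j * scaledCups j + scaledCups j * innerCup (j - 1) := by
  cases j with
  | zero => simp [scaledCups_zero]
  | succ i =>
    apply eq_of_forall_mul
    intro z
    simp only [mul_assoc, add_mul]
    rw [f_cup_mul (i + 1) (by rw [scaledCups_mul, mul_smul_comm, f_mul_f_assoc])]
    have h₁ : cap 0 (2 * (i + 1)) * (scaledCups (i + 1) * z) =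
        (nestedScale (i + 1) : ℂ) • (-((i + 2) / (i + 1)) : ℂ) • (innerCup i * z) := by
      rw [scaledCups_mul, mul_smul_comm, cap_f_cup, innerCup_mul,
        show 2 * (i + 1) - 1 = 2 * i + 1 by omega, f_cup_comm (i := 2 * i + 1) (by omega),
        cap_cup_succ_assoc (by omega)]
    have h₂ : f (i + 1) * (cup 0 (2 * (i + 1)) * (innerCup i * z)) = 0 := by
      rw [innerCup_mul, ← f_cup_comm (by omega), f_mul_f_of_le (Nat.le_succ i),
        show 2 * (i + 1) = 2 * i + 2 by ring, ← cup_cup_assoc le_rfl, f_cup_zero (by omega)]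
    have h₃ : f (i + 1 + 1) * (cup 0 (2 * (i + 1) + 2) * (scaledCups (i + 1) * z)) = 0 := by
      rw [scaledCups_mul, mul_smul_comm, mul_smul_comm, ← f_cup_comm (by omega),
        f_mul_f_of_le (Nat.le_succ _), ← cup_cup_assoc le_rfl, f_cup_zero (by omega), smul_zero]
    rw [h₁, h₃]
    simp only [mul_smul_comm, h₂, smul_zero, mul_zero, Nat.add_sub_cancel]
    match_scalars
    · ring
    · linear_combination -nestedScale_mul_self_mul i

theorem f_cup_add_cup_f_succ :
    f j * (cup 0 (2 * j + 1) + cup 0 (2 * j + 3)) * f (j + 1) =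
      f (j + 1) * outerCup (j + 1) + outerCup j * f (j + 1) := by
  apply eq_of_forall_mul
  intro z
  simp only [mul_assoc, mul_add, add_mul]
  rw [f_cup_comm (i := 2 * j + 3) (by omega), f_mul_f_of_ge (Nat.le_succ j), outerCup_mul,
    outerCup_mul, f_mul_f_assoc, f_cup_comm (j := j + 1) (by omega), add_comm]
  rfl

theorem f_cup_add_cup_outerCup :
    f j * (cup 0 (2 * j + 1) + cup 0 (2 * j + 3)) * outerCup j =
      outerCup j * outerCup j + outerCup j * outerCup j := by
  apply eq_of_forall_mul
  intro z
  simp only [mul_assoc, mul_add, add_mul, outerCup_mul]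
  congr 1
  rw [← f_cup_comm (i := 2 * j + 3) (by omega), ← f_cup_comm (i := 2 * j + 1) (by omega),
    f_mul_f_assoc, f_mul_f_assoc, cup_cup_assoc (i := 2 * j + 1) le_rfl]

theorem f_cup_add_cup_innerCup :
    f j * (cup 0 (2 * j + 1) + cup 0 (2 * j + 3)) * innerCup j =
      outerCup j * innerCup j + innerCup j * outerCup j := by
  apply eq_of_forall_mul
  intro z
  simp only [mul_assoc, mul_add, add_mul]
  congr 1
  · rw [outerCup_mul]
  · rw [innerCup_mul, innerCup_mul, ← f_cup_comm (i := 2 * j + 3) (by omega), f_mul_f_assoc,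
      outerCup_mul, f_mul_f_assoc, f_cup_comm (i := 2 * j + 1) (by omega),
      cup_cup_assoc (i := 2 * j) (by omega)]

theorem f_cup_add_cup_scaledCups :
    f j * (cup 0 (2 * j + 1) + cup 0 (2 * j + 3)) * scaledCups j =
      outerCup j * scaledCups j + scaledCups j * outerCup (j - 1) := by
  apply eq_of_forall_mul
  intro z
  simp only [mul_assoc, mul_add, add_mul]
  congr 1
  · rw [outerCup_mul]
  · cases j with
    | zero => simp [scaledCups_zero]
    | succ i =>
      have h : scaledCups (i + 1) * (outerCup i * z) =
          scaledCups (i + 1) * (cup 0 (2 * i + 1) * z) := by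
        conv_rhs => rw [← scaledCups_mul_f (i + 1)]
        rw [mul_assoc, outerCup_mul]
        rfl
      rw [Nat.add_sub_cancel, h, scaledCups_mul, scaledCups_mul, mul_smul_comm, mul_smul_comm,
        ← f_cup_comm (by omega), f_mul_f_assoc, show 2 * (i + 1) - 1 = 2 * i + 1 by omega,
        cup_cup_assoc (i := 2 * i + 1) le_rfl,
        cup_cup_assoc (i := 2 * (i + 1)) (k := 2 * i + 1 + 2) (by omega)]
      rfl

theorem mul_f_mul_dagger (x : Diagrams 0) : x * f j * dagger x =
    x * f (j + 1) * dagger (x * f (j + 1)) + x * outerCup j * dagger (x * innerCup j) +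
      x * innerCup j * dagger (x * outerCup j) - x * scaledCups j * dagger (x * scaledCups j) := by
  conv_lhs => rw [f_eq_sum j]
  simp only [mul_add, add_mul, mul_sub, sub_mul, dagger_mul, dagger_f, mul_assoc, f_mul_f_assoc]

/-- The idempotent placed between cup and cap makes room for `mul_f_mul_dagger`. -/
theorem f_mul_e_mul_f : f j * e 0 (2 * j + 3) * f j =
    f j * cup 0 (2 * j + 2) * f j * dagger (f j * cup 0 (2 * j + 2)) := by
  apply eq_of_forall_mul
  intro z
  simp only [mul_assoc, dagger_mul, dagger_cup, dagger_f, e]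
  rw [← f_cup_comm (by omega), f_mul_f_assoc]

/-- The four positive terms of `oddConj` factor as the sum of two cups times its reflection; the two
negative ones are the mixed products of two double cups. -/
theorem f_mul_oddConj_mul_f : f j * oddConj (2 * j + 2) * f j =
    f j * (cup 0 (2 * j + 1) + cup 0 (2 * j + 3)) * f j *
      dagger (f j * (cup 0 (2 * j + 1) + cup 0 (2 * j + 3))) -
    outerCup j * outerCup j * dagger (f j * cup 0 (2 * j + 2) * outerCup j) -
    f j * cup 0 (2 * j + 2) * outerCup j * dagger (outerCup j * outerCup j) := by
  apply eq_of_forall_mul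
  intro z
  simp only [oddConj, e, mul_assoc, dagger_mul, dagger_cup, dagger_f, dagger_add, mul_add, add_mul,
    mul_sub, sub_mul, outerCup_mul, dagger_outerCup_mul]
  simp (disch := omega) only [cap_cup_succ_assoc, cap_succ_cup_assoc, ← f_cup_comm, f_mul_f_assoc,
    cap_f_comm]
  have h₁ (y : Diagrams 0) : cap 0 (2 * j + 1) * (cup 0 (2 * j + 3) * y) =
      cup 0 (2 * j + 1) * (cap 0 (2 * j + 1) * y) := cap_cup_far_assoc (by omega) y
  have h₂ : cap 0 (2 * j + 1) * (cap 0 (2 * j + 1) * z) =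
      cap 0 (2 * j + 1) * (cap 0 (2 * j + 3) * z) := cap_cap_assoc le_rfl z
  rw [h₁, h₁, h₂]
  abel

end LocalGenerators

/-! ### Conjugation of an odd generator next to an idempotent -/

namespace HalfConj

variable {m j : ℕ} {x x' y y' : Diagrams 0}

theorem mul_nestedCups (h : HalfConj m (j + 1) x x') :
    HalfConj (m + 1) j (x * nestedCups j) (-(x' * nestedCups j)) := by
  have h₁ : ((nestedScale (j + 1))⁻¹ : ℂ) • scaledCups (j + 1) = nestedCups j := by
    rw [scaledCups, smul_smul, inv_mul_cancel₀ (nestedScale_ne_zero j.succ_ne_zero), one_smul,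
      Nat.add_sub_cancel]
  have := h.mul_scaledCups_succ.smul_real (nestedScale (j + 1))⁻¹
  rwa [smul_neg, Complex.ofReal_inv, ← mul_smul_comm, ← mul_smul_comm, h₁] at this

theorem mul_e_mul_dagger (h : HalfConj m j x x') (h' : HalfConj m j y y') :
    LevelAdjoint (m + 2) (x * e 0 (2 * j + 3) * dagger y)
      (y' * oddConj (2 * j + 2) * dagger x') := by
  -- Let `w` be `f j * cup 0 (2 * j + 2)` and `g` be `f j * (cup 0 (2 * j + 1) + cup 0 (2 * j +
  -- 3))`. Conjugation takes `w f` to `g f` (here `f` is `f (j + 1)`), `w a` to `2 g b - w a`, `w b`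
  -- to `a a`, and `w c` to `-g c`.
  have hu {x x'} (h : HalfConj m j x x') :
      HalfConj (m + 2) (j + 1) (x * (f j * cup 0 (2 * j + 2) * f (j + 1)))
        (x' * (f j * (cup 0 (2 * j + 1) + cup 0 (2 * j + 3)) * f (j + 1))) := by
    rw [f_cup_f_succ, f_cup_add_cup_f_succ]
    simpa only [mul_add, mul_assoc] using h.mul_f_succ.mul_innerCup.add h.mul_innerCup.mul_f_succ
  have ha {x x'} (h : HalfConj m j x x') :
      HalfConj (m + 2) j (x * (f j * cup 0 (2 * j + 2) * outerCup j))
        (x' * (f j * (cup 0 (2 * j + 1) + cup 0 (2 * j + 3)) * innerCup j) +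
          x' * (f j * (cup 0 (2 * j + 1) + cup 0 (2 * j + 3)) * innerCup j) -
          x' * (f j * cup 0 (2 * j + 2) * outerCup j)) := by
    rw [f_cup_outerCup, f_cup_add_cup_innerCup]
    have := (((h.mul_f_succ.mul_nestedCups.add h.mul_outerCup.mul_innerCup).add
      h.mul_innerCup.mul_outerCup).sub (h.mul_scaledCups_mul_f.smul_real (nestedScale j)))
    simp only [mul_add, mul_sub, mul_smul_comm, ← mul_assoc]
    convert this using 1
    module
  have hb {x x'} (h : HalfConj m j x x') :
      HalfConj (m + 2) j (x * (f j * cup 0 (2 * j + 2) * innerCup j))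
        (x' * (outerCup j * outerCup j)) := by
    rw [f_cup_innerCup]
    simpa only [mul_assoc] using h.mul_innerCup.mul_innerCup
  have hc {x x'} (h : HalfConj m j x x') :
      HalfConj (m + 2) (j - 1) (x * (f j * cup 0 (2 * j + 2) * scaledCups j))
        (-(x' * (f j * (cup 0 (2 * j + 1) + cup 0 (2 * j + 3)) * scaledCups j))) := by
    rw [f_cup_scaledCups, f_cup_add_cup_scaledCups]
    have := h.mul_innerCup.mul_scaledCups.add h.mul_scaledCups.mul_innerCup
    simp only [mul_add, ← mul_assoc]
    convert this using 1
    rw [neg_mul_diagram]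
    abel
  have := ((((hu h).mul_dagger (hu h')).add ((ha h).mul_dagger (hb h'))).add
    ((hb h).mul_dagger (ha h'))).sub ((hc h).mul_dagger (hc h'))
  convert this using 1
  · have h₁ : x * e 0 (2 * j + 3) * dagger y = x * (f j * e 0 (2 * j + 3) * f j) * dagger y := by
      conv_lhs => rw [← h.mul_f.1, ← h'.mul_f.1]
      simp only [dagger_mul, dagger_f, mul_assoc]
    rw [h₁, f_mul_e_mul_f, mul_f_mul_dagger]
    simp only [mul_add, add_mul, mul_sub, sub_mul, dagger_mul, mul_assoc]
  · have h₁ : y' * oddConj (2 * j + 2) * dagger x' =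
        y' * (f j * oddConj (2 * j + 2) * f j) * dagger x' := by
      conv_lhs => rw [← h.mul_f.2, ← h'.mul_f.2]
      simp only [dagger_mul, dagger_f, mul_assoc]
    -- As `g a = 2 a a`, the terms `2 g b` supply the mixed part of `g f_k g†`, and the leftover `-w
    -- a` give the two correction terms.
    rw [h₁, f_mul_oddConj_mul_f, mul_f_mul_dagger, f_cup_add_cup_outerCup]
    simp only [dagger_neg, neg_mul_diagram, mul_neg_diagram, neg_neg_diagram, dagger_add,
      dagger_sub, dagger_mul (x := x')]
    generalize f j * (cup 0 (2 * j + 1) + cup 0 (2 * j + 3)) = g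
    generalize f j * cup 0 (2 * j + 2) * outerCup j = w
    simp only [mul_add, add_mul, mul_sub, sub_mul, dagger_mul, mul_assoc]
    abel

end HalfConj

/-! ### Conjugates of the generators, and spanning by matrix units -/

section Generators

theorem e_sq_assoc (i : ℕ) (z : Diagrams 0) : e 0 i * (e 0 i * z) = 0 := by
  cases i with
  | zero => simp [e]
  | succ i => simp only [e, mul_assoc, cap_cup_assoc, mul_zero]

theorem e_comm_assoc {i k : ℕ} (h : i + 2 ≤ k) (z : Diagrams 0) :
    e 0 k * (e 0 i * z) = e 0 i * (e 0 k * z) := by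
  obtain ⟨k, rfl⟩ : ∃ l, k = l + 1 := ⟨k - 1, by omega⟩
  have : e 0 (k + 1) * e 0 i = e 0 i * e 0 (k + 1) := by
    rw [e, mul_assoc, cap_mul_e (by omega), ← mul_assoc, ← e_mul_cup (by omega), mul_assoc]
  rw [← mul_assoc, this, mul_assoc]

theorem e_mul_e_succ_mul_e_assoc {i k : ℕ} (hi : 1 ≤ i) (h : k = i + 1) (z : Diagrams 0) :
    e 0 i * (e 0 k * (e 0 i * z)) = e 0 i * z := by
  obtain ⟨i, rfl⟩ : ∃ l, i = l + 1 := ⟨i - 1, by omega⟩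
  subst h
  simp only [e, mul_assoc, cap_cup_succ_assoc, cap_succ_cup_assoc]

theorem e_succ_mul_e_mul_e_succ_assoc {i k : ℕ} (hi : 1 ≤ i) (h : k = i + 1) (z : Diagrams 0) :
    e 0 k * (e 0 i * (e 0 k * z)) = e 0 k * z := by
  obtain ⟨i, rfl⟩ : ∃ l, i = l + 1 := ⟨i - 1, by omega⟩
  subst h
  simp only [e, mul_assoc, cap_cup_succ_assoc, cap_succ_cup_assoc]

theorem levelAdjoint_e_one : LevelAdjoint 1 (e 0 1) (e 0 2) := by
  have h := HalfConj.path FusionPath.start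
  simpa [halfDiagram, innerCup, outerCup, f_zero, e] using
    h.mul_innerCup.mul_dagger h.mul_innerCup

/-- Multiply by the resolution of the identity on level `m`. The generator slides through `v_p` and
splits into a cup and a cap beside `f_j`, that is, into `a` and its reflection. -/
theorem e_even_eq_sum (m : ℕ) : e 0 (2 * m + 2) =
    ∑ j ∈ Finset.range (m + 1), ∑ p : FusionPath m j,
      halfDiagram p * outerCup j * dagger (halfDiagram p * outerCup j) := by
  rw [← mul_one (e 0 (2 * m + 2)), ← sum_matrixUnit m]
  simp only [Finset.mul_sum]
  refine Finset.sum_congr rfl fun j _ => Finset.sum_congr rfl fun p _ => ?_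
  rw [matrixUnit, ← mul_assoc, e_mul_halfDiagram 0 p, outerCup, ← mul_assoc, halfDiagram_mul_f]
  simp only [dagger_mul, dagger_cup, mul_assoc, e]

theorem levelAdjoint_e_even (m : ℕ) : LevelAdjoint (m + 1) (e 0 (2 * m + 2))
    (∑ j ∈ Finset.range (m + 1), ∑ p : FusionPath m j,
      halfDiagram p * (innerCup j * dagger (innerCup j)) * dagger (halfDiagram p)) := by
  rw [e_even_eq_sum]
  refine LevelAdjoint.sum _ fun j _ => LevelAdjoint.sum _ fun p _ => ?_
  have h := HalfConj.path p
  simpa only [dagger_mul, mul_assoc] using h.mul_outerCup.mul_dagger h.mul_outerCup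

theorem oddConj_mul_halfDiagram {m j : ℕ} (p : FusionPath m j) :
    oddConj (2 * m + 2) * halfDiagram p = halfDiagram p * oddConj (2 * j + 2) := by
  have h (t : ℕ) (z : Diagrams 0) : e 0 (2 * m + 2 + t) * (halfDiagram p * z) =
      halfDiagram p * (e 0 (2 * j + 2 + t) * z) := by
    rw [← mul_assoc, e_mul_halfDiagram, mul_assoc]
  have h₀ := h 0
  rw [add_zero, add_zero] at h₀
  apply eq_of_forall_mul
  intro z
  simp only [oddConj, add_mul, sub_mul, mul_add, mul_sub, mul_assoc, h, h₀]

theorem levelAdjoint_e_odd (m : ℕ) :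
    LevelAdjoint (m + 2) (e 0 (2 * m + 3)) (oddConj (2 * m + 2)) := by
  rw [← mul_one (e 0 (2 * m + 3)), ← mul_one (oddConj (2 * m + 2)), ← sum_matrixUnit m]
  simp only [Finset.mul_sum]
  refine LevelAdjoint.sum _ fun j _ => LevelAdjoint.sum _ fun p _ => ?_
  rw [matrixUnit, ← mul_assoc, ← mul_assoc, oddConj_mul_halfDiagram, e_mul_halfDiagram 1 p]
  exact (HalfConj.path p).mul_e_mul_dagger (HalfConj.path p)

theorem exists_levelAdjoint {x : Diagrams 0} (hx : x ∈ TLInf 0) :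
    ∃ m y, LevelAdjoint m x y := by
  induction hx using Algebra.adjoin_induction with
  | mem x hx =>
    obtain ⟨i, hi, rfl⟩ := hx
    -- For `i = 1` the witness is truncated to zero and plays no role.
    obtain ⟨m, rfl | rfl | rfl⟩ : ∃ m, i = 1 ∨ i = 2 * m + 2 ∨ i = 2 * m + 3 :=
      ⟨(i - 2) / 2, by omega⟩
    · exact ⟨_, _, levelAdjoint_e_one⟩
    · exact ⟨_, _, levelAdjoint_e_even m⟩
    · exact ⟨_, _, levelAdjoint_e_odd m⟩
  | algebraMap c =>
    rw [Algebra.algebraMap_eq_smul_one]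
    exact ⟨_, _, LevelAdjoint.one.smul c⟩
  | add x y _ _ hx hy =>
    obtain ⟨m, x', hx⟩ := hx
    obtain ⟨n, y', hy⟩ := hy
    exact ⟨max m n, _, (hx.mono (le_max_left m n)).add (hy.mono (le_max_right m n))⟩
  | mul x y _ _ hx hy =>
    obtain ⟨m, x', hx⟩ := hx
    obtain ⟨n, y', hy⟩ := hy
    exact ⟨max m n, _, (hx.mono (le_max_left m n)).mul (hy.mono (le_max_right m n))⟩

/-- The number of cups in `v_p` depends only on the length and the end point, so `v_p v_q†` is
balanced and lies in `TL_∞`. -/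
theorem exists_isHalf {m j : ℕ} (p : FusionPath m j) :
    ∃ r, m = j + r ∧ IsHalf r (halfDiagram p) := by
  induction p with
  | start => exact ⟨0, rfl, .tl (one_mem _)⟩
  | up p ih =>
    obtain ⟨r, rfl, h⟩ := ih
    exact ⟨r, by omega, h.mul (f_mem _)⟩
  | @plus m j p ih =>
    obtain ⟨r, rfl, h⟩ := ih
    refine ⟨r + 1, by omega, ?_⟩
    rw [halfDiagram, mul_smul_comm, mul_add, outerCup, innerCup]
    simp only [← mul_assoc]
    exact .smul _ (.add ((h.mul (f_mem j)).mul_cup _) (((h.mul (f_mem j)).mul_cup _).mul (f_mem j)))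
  | @minus m j p ih =>
    obtain ⟨r, rfl, h⟩ := ih
    refine ⟨r + 1, by omega, ?_⟩
    rw [halfDiagram, mul_smul_comm, mul_sub, sub_eq_add_neg, outerCup, innerCup,
      ← neg_one_smul_diagram]
    simp only [← mul_assoc]
    exact .smul _ (.add ((h.mul (f_mem j)).mul_cup _)
      (.smul _ (((h.mul (f_mem j)).mul_cup _).mul (f_mem j))))
  | @down m j p ih =>
    obtain ⟨r, rfl, h⟩ := ih
    refine ⟨r + 2, by omega, ?_⟩
    rw [halfDiagram, mul_smul_comm, nestedCups]
    simp only [← mul_assoc]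
    exact .smul _ ((((h.mul (f_mem _)).mul_cup _).mul_cup _).mul (f_mem j))

theorem matrixUnit_mem {m j : ℕ} (p q : FusionPath m j) : matrixUnit p q ∈ TLInf 0 := by
  obtain ⟨r, hr, hp⟩ := exists_isHalf p
  obtain ⟨r', hr', hq⟩ := exists_isHalf q
  obtain rfl : r = r' := by omega
  exact hp.mul_dagger_mem hq

theorem LevelAdjoint.mem_right {m : ℕ} {x y : Diagrams 0} (h : LevelAdjoint m x y) :
    y ∈ TLInf 0 := by
  induction h with
  | unit p q => exact matrixUnit_mem q p
  | zero => exact zero_mem _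
  | add _ _ h h' => exact add_mem h h'
  | smul c _ h => exact Subalgebra.smul_mem _ h _

theorem LevelAdjoint.unique {m n : ℕ} {x y z : Diagrams 0} (h : LevelAdjoint m x y)
    (h' : LevelAdjoint n x z) : y = z := by
  have := (h.mono (le_max_left m n)).sub (h'.mono (le_max_right m n))
  rw [sub_self] at this
  exact sub_eq_zero.1 this.eq_zero

end Generators

/-! ### Existence and uniqueness of the involution -/

section CorrectedInvolution

/-- The conjugate of an element of `TL_∞`. -/
def correctedFun (x : TLInf 0) : TLInf 0 :=
  ⟨(exists_levelAdjoint x.2).choose_spec.choose,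
    (exists_levelAdjoint x.2).choose_spec.choose_spec.mem_right⟩

theorem correctedFun_spec (x : TLInf 0) : ∃ m, LevelAdjoint m x (correctedFun x) :=
  ⟨_, (exists_levelAdjoint x.2).choose_spec.choose_spec⟩

theorem correctedFun_eq {m : ℕ} {x y : TLInf 0} (h : LevelAdjoint m x y) : correctedFun x = y := by
  obtain ⟨n, hn⟩ := correctedFun_spec x
  exact Subtype.ext (hn.unique h)

/-- The corrected involution. -/
def correctedInvolution : TLInf 0 →ₛₗ[starRingEnd ℂ] TLInf 0 where
  toFun := correctedFun
  map_add' x y := by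
    obtain ⟨m, hx⟩ := correctedFun_spec x
    obtain ⟨n, hy⟩ := correctedFun_spec y
    exact correctedFun_eq ((hx.mono (le_max_left m n)).add (hy.mono (le_max_right m n)))
  map_smul' c x := by
    obtain ⟨m, hx⟩ := correctedFun_spec x
    exact correctedFun_eq (hx.smul c)

theorem isCorrectedInvolution_correctedInvolution : IsCorrectedInvolution correctedInvolution where
  involutive x := by
    obtain ⟨m, hx⟩ := correctedFun_spec x
    exact correctedFun_eq hx.symm
  map_mul x y := by
    obtain ⟨m, hx⟩ := correctedFun_spec x
    obtain ⟨n, hy⟩ := correctedFun_spec y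
    exact correctedFun_eq ((hx.mono (le_max_left m n)).mul (hy.mono (le_max_right m n)))
  matrixUnit m j p q := ⟨matrixUnit_mem p q, congrArg Subtype.val
    (correctedFun_eq (y := ⟨matrixUnit q p, matrixUnit_mem q p⟩) (LevelAdjoint.unit p q))⟩

/-- Prescribed values on matrix units and conjugate linearity already determine `D`; this yields
both uniqueness and the values on generators. -/
theorem IsCorrectedInvolution.eq_of_levelAdjoint {D : TLInf 0 →ₛₗ[starRingEnd ℂ] TLInf 0}
    (hD : IsCorrectedInvolution D) {m : ℕ} {x y : Diagrams 0} (h : LevelAdjoint m x y) :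
    ∃ hx : x ∈ TLInf 0, (D ⟨x, hx⟩ : Diagrams 0) = y := by
  induction h with
  | unit p q => exact hD.matrixUnit _ _ p q
  | zero => exact ⟨zero_mem _, congrArg Subtype.val (map_zero D)⟩
  | add _ _ h h' =>
    obtain ⟨h₁, h₂⟩ := h
    obtain ⟨h₃, h₄⟩ := h'
    exact ⟨add_mem h₁ h₃, (congrArg Subtype.val (map_add D ⟨_, h₁⟩ ⟨_, h₃⟩)).trans
      (congrArg₂ (· + ·) h₂ h₄)⟩
  | smul c _ h =>
    obtain ⟨h₁, h₂⟩ := h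
    exact ⟨Subalgebra.smul_mem _ h₁ c, (congrArg Subtype.val (map_smulₛₗ D c ⟨_, h₁⟩)).trans
      (congrArg (conj c • ·) h₂)⟩

theorem IsCorrectedInvolution.apply_eq {D : TLInf 0 →ₛₗ[starRingEnd ℂ] TLInf 0}
    (hD : IsCorrectedInvolution D) {m : ℕ} {x : TLInf 0} {y : Diagrams 0}
    (h : LevelAdjoint m x y) : (D x : Diagrams 0) = y :=
  (hD.eq_of_levelAdjoint h).2

theorem levelAdjoint_e_four : LevelAdjoint 2 (e 0 4)
    (e 0 1 + e 0 3 - e 0 1 * e 0 2 * e 0 3 - e 0 3 * e 0 2 * e 0 1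
      + e 0 1 * e 0 3 * e 0 2 + e 0 2 * e 0 1 * e 0 3) := by
  -- The sum over paths is avoided: the claimed value is a polynomial in `e_1`, `e_2`, `e_3`, whose
  -- conjugates are known. Its conjugate is computed to be `e_4`, and symmetry gives the claim.
  have h₁ := levelAdjoint_e_one.succ
  have h₂ := h₁.symm
  have h₃ := levelAdjoint_e_odd 0
  have h := (((((h₁.add h₃).sub ((h₁.mul h₂).mul h₃)).sub ((h₃.mul h₂).mul h₁)).add
    ((h₁.mul h₃).mul h₂)).add ((h₂.mul h₁).mul h₃)).symm
  convert h using 1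
  have h₄ (z : Diagrams 0) : e 0 2 * (e 0 4 * (e 0 3 * (e 0 2 * z))) = e 0 2 * (e 0 4 * z) := by
    rw [← e_comm_assoc le_rfl, e_mul_e_succ_mul_e_assoc (by norm_num) rfl, e_comm_assoc le_rfl]
  apply eq_of_forall_mul
  intro z
  simp only [oddConj, mul_add, add_mul, mul_sub, sub_mul, mul_assoc]
  simp (disch := omega) only [mul_zero, zero_add, add_zero, e_sq_assoc, e_comm_assoc,
    e_mul_e_succ_mul_e_assoc, e_succ_mul_e_mul_e_succ_assoc, Nat.reduceAdd, h₄]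
  abel

end CorrectedInvolution

end

end TemperleyLieb


theorem mainTheorem6 :
    (∃! D : TemperleyLieb.TLInf 0 →ₛₗ[starRingEnd ℂ] TemperleyLieb.TLInf 0,
      TemperleyLieb.IsCorrectedInvolution D) ∧
    ∀ D : TemperleyLieb.TLInf 0 →ₛₗ[starRingEnd ℂ] TemperleyLieb.TLInf 0,
      TemperleyLieb.IsCorrectedInvolution D →
      -- the first generator
      D (TemperleyLieb.gen 0 1) = TemperleyLieb.gen 0 2 ∧
      -- the even generators with index greater than two
      (∀ m : ℕ, 1 ≤ m →
        (D (TemperleyLieb.gen 0 (2 * m + 2)) : TemperleyLieb.Diagrams 0) =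
          ∑ j ∈ Finset.range (m + 1), ∑ p : TemperleyLieb.FusionPath m j,
            TemperleyLieb.halfDiagram p *
              (TemperleyLieb.innerCup j * TemperleyLieb.dagger (TemperleyLieb.innerCup j)) *
              TemperleyLieb.dagger (TemperleyLieb.halfDiagram p) ∧
        (D (TemperleyLieb.gen 0 (2 * m + 2)) : TemperleyLieb.Diagrams 0) =
          ∑ j ∈ Finset.range (m + 1), ∑ p : TemperleyLieb.FusionPath m j,
            TemperleyLieb.halfDiagram p *
              (TemperleyLieb.f j * TemperleyLieb.e 0 (2 * j + 1) * TemperleyLieb.f j) *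
              TemperleyLieb.dagger (TemperleyLieb.halfDiagram p)) ∧
      -- the odd generators with index greater than two
      (∀ n : ℕ, 2 < n → Odd n →
        D (TemperleyLieb.gen 0 n) =
          TemperleyLieb.gen 0 (n - 1) + TemperleyLieb.gen 0 (n + 1)
          + TemperleyLieb.gen 0 (n - 1) * TemperleyLieb.gen 0 n * TemperleyLieb.gen 0 (n + 1)
          + TemperleyLieb.gen 0 (n + 1) * TemperleyLieb.gen 0 n * TemperleyLieb.gen 0 (n - 1)
          - TemperleyLieb.gen 0 (n - 1) * TemperleyLieb.gen 0 (n + 1) * TemperleyLieb.gen 0 n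
          - TemperleyLieb.gen 0 n * TemperleyLieb.gen 0 (n - 1) * TemperleyLieb.gen 0 (n + 1)) ∧
      -- the example
      D (TemperleyLieb.gen 0 4) =
        TemperleyLieb.gen 0 1 + TemperleyLieb.gen 0 3
        - TemperleyLieb.gen 0 1 * TemperleyLieb.gen 0 2 * TemperleyLieb.gen 0 3
        - TemperleyLieb.gen 0 3 * TemperleyLieb.gen 0 2 * TemperleyLieb.gen 0 1
        + TemperleyLieb.gen 0 1 * TemperleyLieb.gen 0 3 * TemperleyLieb.gen 0 2
        + TemperleyLieb.gen 0 2 * TemperleyLieb.gen 0 1 * TemperleyLieb.gen 0 3 := by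
  refine ⟨⟨_, TemperleyLieb.isCorrectedInvolution_correctedInvolution, fun D hD => ?_⟩,
    fun D hD => ⟨?_, fun m _ => ?_, fun n hn hn' => ?_, ?_⟩⟩
  · ext x
    obtain ⟨m, hx⟩ := TemperleyLieb.correctedFun_spec x
    exact hD.apply_eq hx
  · exact Subtype.ext (hD.apply_eq TemperleyLieb.levelAdjoint_e_one)
  · have h := hD.apply_eq (x := TemperleyLieb.gen 0 (2 * m + 2))
      (TemperleyLieb.levelAdjoint_e_even m)
    refine ⟨h, ?_⟩
    simpa only [TemperleyLieb.innerCup_mul_dagger] using h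
  · obtain ⟨m, rfl⟩ : ∃ m, n = 2 * m + 3 := by
      obtain ⟨k, rfl⟩ := hn'
      exact ⟨k - 1, by omega⟩
    exact Subtype.ext (hD.apply_eq (x := TemperleyLieb.gen 0 (2 * m + 3))
      (TemperleyLieb.levelAdjoint_e_odd m))
  · exact Subtype.ext (hD.apply_eq (x := TemperleyLieb.gen 0 4)
      TemperleyLieb.levelAdjoint_e_four)
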